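/- Let $k$ be a field, let $\mathscr C,\mathscr D$ be $k$-linear abelian monoidal categories with $k$-bilinear tensor products, and let $F:\mathscr C\to\mathscr D$ be a $k$-linear (strong) monoidal functor, with structure isomorphisms $F(X)\otimes F(Y)\cong F(X\otimes Y)$ and $1\cong F(1)$. The centralizer $\mathcal Z(F)$ is the monoidal category of pairs $(U,\rho)$, where $U\in\mathscr D$ and $\rho(X):U\otimes F(X)\cong F(X)\otimes U$ is a natural isomorphism such that, up to the identification $F(X)\otimes F(Y)\cong F(X\otimes Y)$, $\rho(X\otimes Y)=(F(X)\otimes\rho(Y))\circ(\rho(X)\otimes F(Y))$; morphisms are the morphisms of $\mathscr D$ compatible with the half-braidings, and $(U,\rho)\otimes(V,\sigma)$ is $U\otimes V$ with half-braiding $(\rho(X)\otimes V)\circ(U\otimes\sigma(X))$. Let $(U,\rho,\Delta,\epsilon)$ be a coalgebra object in $\mathcal Z(F)$. For $n\ge 0$ let $F^{\otimes n}(X_1,\dots,X_n)=F(X_1)\otimes\dots\otimes F(X_n)$ (the unit object if $n=0$) and $C^n(F,U)=\mathrm{Nat}(U\otimes F^{\otimes n},F^{\otimes n})$ (so $C^0(F,U)=\mathrm{Hom}(U,1)$).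 Suppressing associativity and unit isomorphisms and the structure isomorphisms of $F$, put $$\delta(f)_{X_0,\dots,X_n}=(F(X_0)\otimes f_{X_1,\dots,X_n})\circ(\rho(X_0)\otimes F(X_1)\otimes\dots\otimes F(X_n))+\sum_{i=1}^n(-1)^if_{X_0,\dots,X_{i-1}\otimes X_i,\dots,X_n}+(-1)^{n+1}f_{X_0,\dots,X_{n-1}}\otimes F(X_n).$$ Then $\delta\circ\delta=0$; let $H^\bullet_{DY}(F,U)$ be the cohomology of this complex. Let $\rho(X_1,\dots,X_m):U\otimes F(X_1)\otimes\dots\otimes F(X_m)\to F(X_1)\otimes\dots\otimes F(X_m)\otimes U$ be the iterated half-braiding. For $f\in C^m(F,U)$, $g\in C^n(F,U)$ let $f\cup g,\ f\sqcup g\in C^{m+n}(F,U)$ be given, with $G=F(X_1)\otimes\dots\otimes F(X_m)$ and $G'=F(X_{m+1})\otimes\dots\otimes F(X_{m+n})$, by $$(f\cup g)_{X_1,\dots,X_{m+n}}=(f_{X_1,\dots,X_m}\otimes g_{X_{m+1},\dots,X_{m+n}})\circ(U\otimes\rho(X_1,\dots,X_m)\otimes G')\circ(\Delta\otimes G\otimes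 G'),$$ $$(f\sqcup g)_{X_1,\dots,X_{m+n}}=(G\otimes g_{X_{m+1},\dots,X_{m+n}})\circ(\rho(X_1,\dots,X_m)\otimes G')\circ(U\otimes f_{X_1,\dots,X_m}\otimes G')\circ(\Delta\otimes G\otimes G').$$ (a) If $f$ and $g$ are cocycles, so are $f\cup g$ and $f\sqcup g$, and both products descend to $k$-bilinear products $H^m_{DY}(F,U)\times H^n_{DY}(F,U)\to H^{m+n}_{DY}(F,U)$ for all $m,n\ge 0$. Each of them makes $H^\bullet_{DY}(F,U)$ a graded associative $k$-algebra, with unit the class of $\epsilon\in C^0(F,U)$. (b) For all $m,n\ge0$, $\bar f\in H^m_{DY}(F,U)$ and $\bar g\in H^n_{DY}(F,U)$, one has $\bar f\cup\bar g=(-1)^{mn}\,\bar g\sqcup\bar f$ in $H^{m+n}_{DY}(F,U)$. -/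

import Mathlib

open CategoryTheory MonoidalCategory

noncomputable section

namespace DavydovYetter

universe w v₁ v₂ u₁ u₂

section Centralizer

variable {C : Type u₁} [Category.{v₁} C] [MonoidalCategory C]
variable {D : Type u₂} [Category.{v₂} D] [MonoidalCategory D]

/-- A half-braiding on `U : D` relative to the monoidal functor `F : C ⥤ D`: a natural isomorphism
`U ⊗ F(-) ≅ F(-) ⊗ U` compatible with the structure isomorphisms `F X ⊗ F Y ≅ F (X ⊗ Y)`. -/
structure HalfBraiding (F : C ⥤ D) [F.Monoidal] (U : D) where
  /-- The components of the half-braiding. -/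
  β : ∀ X : C, U ⊗ F.obj X ≅ F.obj X ⊗ U
  naturality : ∀ {X Y : C} (φ : X ⟶ Y),
    U ◁ F.map φ ≫ (β Y).hom = (β X).hom ≫ F.map φ ▷ U
  monoidal : ∀ X Y : C,
    U ◁ Functor.LaxMonoidal.μ F X Y ≫ (β (X ⊗ Y)).hom =
      (α_ U (F.obj X) (F.obj Y)).inv ≫ (β X).hom ▷ F.obj Y ≫ (α_ (F.obj X) U (F.obj Y)).hom ≫
        F.obj X ◁ (β Y).hom ≫ (α_ (F.obj X) (F.obj Y) U).inv ≫
          Functor.LaxMonoidal.μ F X Y ▷ U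

namespace HalfBraiding

variable {F : C ⥤ D} [F.Monoidal]

/-- The half-braiding on `U ⊗ V`: move `F X` first past `V`, then past `U`. -/
def tensor {U V : D} (b : HalfBraiding F U) (c : HalfBraiding F V) : HalfBraiding F (U ⊗ V) where
  β := fun X =>
    α_ _ _ _ ≪≫ whiskerLeftIso U (c.β X) ≪≫ (α_ _ _ _).symm ≪≫
      whiskerRightIso (b.β X) V ≪≫ α_ _ _ _
  naturality := fun {X Y} φ => by
    simp only [Iso.trans_hom, whiskerLeftIso_hom, Iso.symm_hom, whiskerRightIso_hom]
    calc
      _ = 𝟙 _ ⊗≫ (U ◁ (V ◁ F.map φ ≫ (c.β Y).hom)) ⊗≫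
          (b.β Y).hom ▷ V ⊗≫ 𝟙 _ := by monoidal
      _ = 𝟙 _ ⊗≫ U ◁ (c.β X).hom ⊗≫
          (U ◁ F.map φ ≫ (b.β Y).hom) ▷ V ⊗≫ 𝟙 _ := by
        rw [c.naturality]; monoidal
      _ = _ := by rw [b.naturality]; monoidal
  monoidal := fun X Y => by
    simp only [Iso.trans_hom, whiskerLeftIso_hom, Iso.symm_hom, whiskerRightIso_hom]
    calc
      _ = 𝟙 _ ⊗≫
          U ◁ (V ◁ Functor.LaxMonoidal.μ F X Y ≫ (c.β (X ⊗ Y)).hom) ⊗≫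
            (b.β (X ⊗ Y)).hom ▷ V ⊗≫ 𝟙 _ := by monoidal
      _ = 𝟙 _ ⊗≫ U ◁ (c.β X).hom ▷ F.obj Y ⊗≫
          U ◁ F.obj X ◁ (c.β Y).hom ⊗≫
            (U ◁ Functor.LaxMonoidal.μ F X Y ≫ (b.β (X ⊗ Y)).hom) ▷ V ⊗≫
              𝟙 _ := by
        rw [c.monoidal]; monoidal
      _ = 𝟙 _ ⊗≫ U ◁ (c.β X).hom ▷ F.obj Y ⊗≫
          ((U ⊗ F.obj X) ◁ (c.β Y).hom ≫ (b.β X).hom ▷ (F.obj Y ⊗ V)) ⊗≫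
            F.obj X ◁ (b.β Y).hom ▷ V ⊗≫
              Functor.LaxMonoidal.μ F X Y ▷ U ▷ V ⊗≫ 𝟙 _ := by
        rw [b.monoidal]; monoidal
      _ = _ := by rw [whisker_exchange]; monoidal

variable (F) in
/-- The half-braiding on the unit object given by the unitors. -/
def unit : HalfBraiding F (𝟙_ D) where
  β := fun X => λ_ (F.obj X) ≪≫ (ρ_ (F.obj X)).symm
  naturality := fun φ => by simp
  monoidal := fun X Y => by
    simp only [Iso.trans_hom, Iso.symm_hom]
    rw [leftUnitor_naturality_assoc, rightUnitor_inv_naturality]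
    monoidal

theorem tensor_β_hom {U V : D} (b : HalfBraiding F U) (c : HalfBraiding F V) (X : C) :
    ((b.tensor c).β X).hom = (α_ _ _ _).hom ≫ U ◁ (c.β X).hom ≫ (α_ _ _ _).inv ≫
      (b.β X).hom ▷ V ≫ (α_ _ _ _).hom := rfl

theorem unit_β_hom (X : C) :
    ((unit F).β X).hom = (λ_ (F.obj X)).hom ≫ (ρ_ (F.obj X)).inv := rfl

theorem whiskerLeft_comm {U V W : D} (a : HalfBraiding F U) (b : HalfBraiding F V)
    (c : HalfBraiding F W) (f : V ⟶ W)
    (hf : ∀ X : C, f ▷ F.obj X ≫ (c.β X).hom = (b.β X).hom ≫ F.obj X ◁ f) (X : C) :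
    (U ◁ f) ▷ F.obj X ≫ ((a.tensor c).β X).hom =
      ((a.tensor b).β X).hom ≫ F.obj X ◁ (U ◁ f) := by
  rw [tensor_β_hom, tensor_β_hom]
  calc
    _ = 𝟙 _ ⊗≫ U ◁ (f ▷ F.obj X ≫ (c.β X).hom) ⊗≫ (a.β X).hom ▷ W ⊗≫ 𝟙 _ := by monoidal
    _ = 𝟙 _ ⊗≫ U ◁ (b.β X).hom ⊗≫
        ((U ⊗ F.obj X) ◁ f ≫ (a.β X).hom ▷ W) ⊗≫ 𝟙 _ := by
      rw [hf]; monoidal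
    _ = _ := by rw [whisker_exchange]; monoidal

theorem whiskerRight_comm {U V W : D} (a : HalfBraiding F U) (b : HalfBraiding F V)
    (c : HalfBraiding F W) (f : U ⟶ V)
    (hf : ∀ X : C, f ▷ F.obj X ≫ (b.β X).hom = (a.β X).hom ≫ F.obj X ◁ f) (X : C) :
    (f ▷ W) ▷ F.obj X ≫ ((b.tensor c).β X).hom =
      ((a.tensor c).β X).hom ≫ F.obj X ◁ (f ▷ W) := by
  rw [tensor_β_hom, tensor_β_hom]
  calc
    _ = 𝟙 _ ⊗≫ (f ▷ (W ⊗ F.obj X) ≫ V ◁ (c.β X).hom) ⊗≫ (b.β X).hom ▷ W ⊗≫ 𝟙 _ := by monoidal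
    _ = 𝟙 _ ⊗≫ U ◁ (c.β X).hom ⊗≫ (f ▷ F.obj X ≫ (b.β X).hom) ▷ W ⊗≫ 𝟙 _ := by
      rw [← whisker_exchange]; monoidal
    _ = _ := by rw [hf]; monoidal

theorem associator_comm {U V W : D} (a : HalfBraiding F U) (b : HalfBraiding F V)
    (c : HalfBraiding F W) (X : C) :
    (α_ U V W).hom ▷ F.obj X ≫ ((a.tensor (b.tensor c)).β X).hom =
      (((a.tensor b).tensor c).β X).hom ≫ F.obj X ◁ (α_ U V W).hom := by
  simp only [tensor_β_hom]
  monoidal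

theorem leftUnitor_comm {U : D} (a : HalfBraiding F U) (X : C) :
    (λ_ U).hom ▷ F.obj X ≫ (a.β X).hom =
      (((unit F).tensor a).β X).hom ≫ F.obj X ◁ (λ_ U).hom := by
  simp only [tensor_β_hom, unit_β_hom]
  monoidal

theorem rightUnitor_comm {U : D} (a : HalfBraiding F U) (X : C) :
    (ρ_ U).hom ▷ F.obj X ≫ (a.β X).hom =
      ((a.tensor (unit F)).β X).hom ≫ F.obj X ◁ (ρ_ U).hom := by
  simp only [tensor_β_hom, unit_β_hom]
  monoidal

end HalfBraiding

/-- The centralizer `𝒵(F)` of a monoidal functor: objects of `D` with a half-braiding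
relative to `F`. -/
structure Centralizer (F : C ⥤ D) [F.Monoidal] where
  /-- The underlying object. -/
  pt : D
  /-- The half-braiding. -/
  braid : HalfBraiding F pt

namespace Centralizer

variable {F : C ⥤ D} [F.Monoidal]

/-- A morphism in the centralizer: a morphism in `D` compatible with the half-braidings. -/
@[ext]
structure Hom (U V : Centralizer F) where
  /-- The underlying morphism. -/
  f : U.pt ⟶ V.pt
  comm : ∀ X : C, f ▷ F.obj X ≫ (V.braid.β X).hom = (U.braid.β X).hom ≫ F.obj X ◁ f

instance : Quiver (Centralizer F) where
  Hom := Hom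

@[ext]
theorem hom_ext {U V : Centralizer F} (f g : U ⟶ V) (w : f.f = g.f) : f = g :=
  Hom.ext w

instance : Category (Centralizer F) where
  id U := { f := 𝟙 U.pt, comm := by simp }
  comp {U V W} f g :=
    { f := f.f ≫ g.f
      comm := fun X => by
        rw [comp_whiskerRight, Category.assoc, g.comm, ← Category.assoc, f.comm,
          Category.assoc, MonoidalCategory.whiskerLeft_comp] }

@[simp]
theorem id_f (U : Centralizer F) : Hom.f (𝟙 U) = 𝟙 U.pt := rfl

@[simp]
theorem comp_f {U V W : Centralizer F} (f : U ⟶ V) (g : V ⟶ W) : (f ≫ g).f = f.f ≫ g.f := rfl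

/-- A morphism of the centralizer whose underlying morphism is an isomorphism is one. -/
@[simps]
def isoMk {U V : Centralizer F} (e : U.pt ≅ V.pt)
    (h : ∀ X : C, e.hom ▷ F.obj X ≫ (V.braid.β X).hom = (U.braid.β X).hom ≫ F.obj X ◁ e.hom) :
    U ≅ V where
  hom := ⟨e.hom, h⟩
  inv := ⟨e.inv, fun X => by
    rw [← cancel_epi (e.hom ▷ F.obj X), ← Category.assoc, ← Category.assoc, ← comp_whiskerRight,
      h X, Category.assoc, ← MonoidalCategory.whiskerLeft_comp]
    simp⟩
  hom_inv_id := by ext; simp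
  inv_hom_id := by ext; simp

/-- The tensor product of two objects of the centralizer. -/
@[reducible]
def tensorObj (U V : Centralizer F) : Centralizer F where
  pt := U.pt ⊗ V.pt
  braid := U.braid.tensor V.braid

/-- The unit object of the centralizer. -/
@[reducible]
def tensorUnit : Centralizer F where
  pt := 𝟙_ D
  braid := HalfBraiding.unit F

/-- The monoidal structure on the centralizer induced by that of `D`. -/
instance : MonoidalCategory (Centralizer F) where
  tensorObj U V := tensorObj U V
  whiskerLeft U _ _ f := ⟨U.pt ◁ f.f, HalfBraiding.whiskerLeft_comm _ _ _ f.f f.comm⟩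
  whiskerRight f W := ⟨f.f ▷ W.pt, HalfBraiding.whiskerRight_comm _ _ _ f.f f.comm⟩
  tensorUnit := tensorUnit
  associator U V W := isoMk (α_ U.pt V.pt W.pt)
    (HalfBraiding.associator_comm U.braid V.braid W.braid)
  leftUnitor U := isoMk (λ_ U.pt) (HalfBraiding.leftUnitor_comm U.braid)
  rightUnitor U := isoMk (ρ_ U.pt) (HalfBraiding.rightUnitor_comm U.braid)
  tensorHom_comp_tensorHom f₁ f₂ g₁ g₂ := hom_ext _ _ (by
    change (f₁.f ▷ _ ≫ _ ◁ f₂.f) ≫ (g₁.f ▷ _ ≫ _ ◁ g₂.f) =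
      (f₁.f ≫ g₁.f) ▷ _ ≫ _ ◁ (f₂.f ≫ g₂.f)
    simp [whisker_exchange_assoc])
  id_tensorHom_id U V := hom_ext _ _ (by
    change 𝟙 U.pt ▷ V.pt ≫ U.pt ◁ 𝟙 V.pt = 𝟙 (U.pt ⊗ V.pt)
    simp)
  whiskerLeft_id U V := hom_ext _ _ (MonoidalCategory.whiskerLeft_id U.pt V.pt)
  id_whiskerRight U V := hom_ext _ _ (MonoidalCategory.id_whiskerRight U.pt V.pt)
  associator_naturality {X₁ X₂ X₃ Y₁ Y₂ Y₃} f₁ f₂ f₃ := hom_ext _ _ (by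
    change ((f₁.f ▷ X₂.pt ≫ Y₁.pt ◁ f₂.f) ▷ X₃.pt ≫ (Y₁.pt ⊗ Y₂.pt) ◁ f₃.f) ≫ (α_ _ _ _).hom =
      (α_ _ _ _).hom ≫ f₁.f ▷ (X₂.pt ⊗ X₃.pt) ≫ Y₁.pt ◁ (f₂.f ▷ X₃.pt ≫ Y₂.pt ◁ f₃.f)
    simp)
  leftUnitor_naturality f := hom_ext _ _ (MonoidalCategory.leftUnitor_naturality f.f)
  rightUnitor_naturality f := hom_ext _ _ (MonoidalCategory.rightUnitor_naturality f.f)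
  pentagon W X Y Z := hom_ext _ _ (MonoidalCategory.pentagon W.pt X.pt Y.pt Z.pt)
  triangle X Y := hom_ext _ _ (MonoidalCategory.triangle X.pt Y.pt)

theorem tensor_pt (U V : Centralizer F) : (U ⊗ V).pt = U.pt ⊗ V.pt := rfl

theorem tensor_β (U V : Centralizer F) (X : C) :
    (U ⊗ V).braid.β X =
      α_ _ _ _ ≪≫ whiskerLeftIso U.pt (V.braid.β X) ≪≫ (α_ _ _ _).symm ≪≫
        whiskerRightIso (U.braid.β X) V.pt ≪≫ α_ _ _ _ := rfl

theorem unit_pt : (𝟙_ (Centralizer F)).pt = 𝟙_ D := rfl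

theorem unit_β (X : C) :
    (𝟙_ (Centralizer F)).braid.β X = λ_ (F.obj X) ≪≫ (ρ_ (F.obj X)).symm := rfl

theorem whiskerLeft_f (U : Centralizer F) {V W : Centralizer F} (f : V ⟶ W) :
    (U ◁ f).f = U.pt ◁ f.f := rfl

theorem whiskerRight_f {U V : Centralizer F} (f : U ⟶ V) (W : Centralizer F) :
    (f ▷ W).f = f.f ▷ W.pt := rfl

theorem associator_hom_f (U V W : Centralizer F) :
    (α_ U V W).hom.f = (α_ U.pt V.pt W.pt).hom := rfl

theorem leftUnitor_inv_f (U : Centralizer F) : (λ_ U).inv.f = (λ_ U.pt).inv := rfl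

theorem rightUnitor_inv_f (U : Centralizer F) : (ρ_ U).inv.f = (ρ_ U.pt).inv := rfl

end Centralizer

end Centralizer

section Complex

variable {C : Type u₁} [Category.{v₁} C]
variable {D : Type u₂} [Category.{v₂} D] [MonoidalCategory D]

/-- The functor `F^{⊗ n} : Cⁿ ⥤ D`, `(X₁, …, Xₙ) ↦ F X₁ ⊗ (F X₂ ⊗ ( ⋯ ⊗ (F Xₙ ⊗ 𝟙)))`.
For `n = 0` it is the unit object, regarded as a functor on the category `C⁰` with one
morphism. -/
def tensorPow (F : C ⥤ D) : (n : ℕ) → (Fin n → C) ⥤ D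
  | 0 => (Functor.const _).obj (𝟙_ D)
  | n + 1 =>
    { obj := fun X => F.obj (X 0) ⊗ (tensorPow F n).obj (fun i => X i.succ)
      map := fun {X Y} φ =>
        F.map (φ 0) ⊗ₘ (tensorPow F n).map
          (X := fun i => X i.succ) (Y := fun i => Y i.succ) (fun i => φ i.succ)
      map_id := fun X => by
        have h := (tensorPow F n).map_id (fun i => X i.succ)
        have h' : F.map ((𝟙 X : X ⟶ X) 0) = 𝟙 (F.obj (X 0)) := F.map_id (X 0)
        exact (congrArg₂ (fun a b => a ⊗ₘ b) h' h).trans (id_tensorHom_id _ _)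
      map_comp := fun {X Y Z} φ χ => by
        have h := (tensorPow F n).map_comp (X := fun i => X i.succ) (Y := fun i => Y i.succ)
          (Z := fun i => Z i.succ) (fun i => φ i.succ) (fun i => χ i.succ)
        have h' : F.map ((φ ≫ χ) 0) = F.map (φ 0) ≫ F.map (χ 0) := F.map_comp _ _
        exact (congrArg₂ (fun a b => a ⊗ₘ b) h' h).trans (tensorHom_comp_tensorHom _ _ _ _).symm }

/-- The functor `C^N ⥤ C^m` keeping the first `m` of `N = m + n` entries. -/
@[simps]
def front {m n N : ℕ} (h : m + n = N) : (Fin N → C) ⥤ (Fin m → C) where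
  obj X := fun i => X ⟨i, by omega⟩
  map φ := fun i => φ ⟨i, by omega⟩

/-- The functor `C^N ⥤ C^n` keeping the last `n` of `N = m + n` entries. -/
@[simps]
def back {m n N : ℕ} (h : m + n = N) : (Fin N → C) ⥤ (Fin n → C) where
  obj X := fun j => X ⟨j + m, by omega⟩
  map φ := fun j => φ ⟨j + m, by omega⟩

/-- The canonical isomorphism, made of associators and a unitor,
`F X₁ ⊗ ⋯ ⊗ F X_{m+n} ≅ (F X₁ ⊗ ⋯ ⊗ F Xₘ) ⊗ (F X_{m+1} ⊗ ⋯ ⊗ F X_{m+n})`. -/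
def split (F : C ⥤ D) : {m n N : ℕ} → (h : m + n = N) → (X : Fin N → C) →
    ((tensorPow F N).obj X ≅
      (tensorPow F m).obj ((front h).obj X) ⊗ (tensorPow F n).obj ((back h).obj X))
  | 0, n, N, h, X =>
    match N, (Nat.zero_add n).symm.trans h, h, X with
    | _, rfl, _, X => (λ_ ((tensorPow F n).obj X)).symm
  | m + 1, n, 0, h, _ => absurd h (by omega)
  | m + 1, n, N + 1, h, X =>
    whiskerLeftIso (F.obj (X 0))
        (split F (m := m) (n := n) (N := N) (by omega) (fun i => X i.succ)) ≪≫
      (α_ _ _ _).symm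

theorem split_naturality (F : C ⥤ D) : ∀ {m n N : ℕ} (h : m + n = N) {X Y : Fin N → C}
    (φ : X ⟶ Y),
    (tensorPow F N).map φ ≫ (split F h Y).hom =
      (split F h X).hom ≫
        ((tensorPow F m).map ((front h).map φ) ⊗ₘ (tensorPow F n).map ((back h).map φ))
  | 0, n, N, h, X, Y, φ => by
    obtain rfl : n = N := (Nat.zero_add n).symm.trans h
    change (tensorPow F n).map φ ≫ (λ_ ((tensorPow F n).obj Y)).inv =
      (λ_ ((tensorPow F n).obj X)).inv ≫ (𝟙 (𝟙_ D) ⊗ₘ (tensorPow F n).map φ)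
    rw [id_tensorHom, leftUnitor_inv_naturality]
  | m + 1, n, 0, h, _, _, _ => absurd h (by omega)
  | m + 1, n, N + 1, h, X, Y, φ => by
    have ih := split_naturality F (m := m) (n := n) (N := N) (by omega)
      (X := fun i => X i.succ) (Y := fun i => Y i.succ) (fun i => φ i.succ)
    change (F.map (φ 0) ⊗ₘ (tensorPow F N).map (X := fun i => X i.succ)
        (Y := fun i => Y i.succ) (fun i => φ i.succ)) ≫
      (F.obj (Y 0) ◁ (split F (m := m) (n := n) (N := N) (by omega) (fun i => Y i.succ)).hom ≫
        (α_ _ _ _).inv) =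
      (F.obj (X 0) ◁ (split F (m := m) (n := n) (N := N) (by omega) (fun i => X i.succ)).hom ≫
        (α_ _ _ _).inv) ≫
        ((F.map (φ 0) ⊗ₘ (tensorPow F m).map ((front (by omega)).map
          (X := fun i => X i.succ) (Y := fun i => Y i.succ) (fun i => φ i.succ))) ⊗ₘ
            (tensorPow F n).map ((back (by omega)).map
          (X := fun i => X i.succ) (Y := fun i => Y i.succ) (fun i => φ i.succ)))
    rw [Category.assoc, ← associator_inv_naturality, ← id_tensorHom, ← id_tensorHom,
      tensorHom_comp_tensorHom_assoc, tensorHom_comp_tensorHom_assoc, ih]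
    simp only [Category.comp_id, Category.id_comp]

theorem split_inv_naturality (F : C ⥤ D) {m n N : ℕ} (h : m + n = N) {X Y : Fin N → C}
    (φ : X ⟶ Y) :
    (split F h X).inv ≫ (tensorPow F N).map φ =
      ((tensorPow F m).map ((front h).map φ) ⊗ₘ (tensorPow F n).map ((back h).map φ)) ≫
        (split F h Y).inv := by
  rw [Iso.inv_comp_eq, ← Category.assoc, Iso.eq_comp_inv, split_naturality]

/-- A morphism of `(n + 1)`-tuples from its first component and the remaining ones. -/
def consHom {n : ℕ} {X Y : Fin (n + 1) → C} (a : X 0 ⟶ Y 0)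
    (b : ∀ j : Fin n, X j.succ ⟶ Y j.succ) : X ⟶ Y :=
  fun i => Fin.cases (motive := fun i => X i ⟶ Y i) a b i

variable [MonoidalCategory C]

/-- The functor `Cⁿ⁺¹ ⥤ Cⁿ` replacing the two neighbouring entries in positions `i`, `i + 1`
(counted from `0`) by their tensor product. -/
def merge : {n : ℕ} → (i : Fin n) → (Fin (n + 1) → C) ⥤ (Fin n → C)
  | n + 1, ⟨0, _⟩ =>
    { obj := fun X => Fin.cons (X 0 ⊗ X 1) (fun j => X j.succ.succ)
      map := fun {X Y} φ => consHom (φ 0 ⊗ₘ φ 1) (fun j => φ j.succ.succ)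
      map_id := fun X => by
        funext j
        refine Fin.cases ?_ (fun j => ?_) j
        · exact id_tensorHom_id (X 0) (X 1)
        · rfl
      map_comp := fun {X Y Z} φ χ => by
        funext j
        refine Fin.cases ?_ (fun j => ?_) j
        · exact (tensorHom_comp_tensorHom (φ 0) (φ 1) (χ 0) (χ 1)).symm
        · rfl }
  | n + 1, ⟨i + 1, hi⟩ =>
    { obj := fun X => Fin.cons (X 0)
        ((merge (n := n) ⟨i, by omega⟩).obj (fun j => X j.succ))
      map := fun {X Y} φ => consHom (φ 0)
        ((merge (n := n) ⟨i, by omega⟩).map (X := fun j => X j.succ) (Y := fun j => Y j.succ)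
          (fun j => φ j.succ))
      map_id := fun X => by
        funext j
        refine Fin.cases ?_ (fun j => ?_) j
        · rfl
        · exact congrFun ((merge (n := n) ⟨i, by omega⟩).map_id (fun j => X j.succ)) j
      map_comp := fun {X Y Z} φ χ => by
        funext j
        refine Fin.cases ?_ (fun j => ?_) j
        · rfl
        · exact congrFun ((merge (n := n) ⟨i, by omega⟩).map_comp (X := fun j => X j.succ)
            (Y := fun j => Y j.succ) (Z := fun j => Z j.succ)
            (fun j => φ j.succ) (fun j => χ j.succ)) j }

variable (F : C ⥤ D) [F.Monoidal]

/-- The isomorphism `F X₀ ⊗ ⋯ ⊗ F Xₙ ≅ F X₀ ⊗ ⋯ ⊗ F (Xᵢ ⊗ Xᵢ₊₁) ⊗ ⋯ ⊗ F Xₙ` induced by the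
structure isomorphism `F Xᵢ ⊗ F Xᵢ₊₁ ≅ F (Xᵢ ⊗ Xᵢ₊₁)`. -/
def mergeIso : {n : ℕ} → (i : Fin n) → (X : Fin (n + 1) → C) →
    ((tensorPow F (n + 1)).obj X ≅ (tensorPow F n).obj ((merge i).obj X))
  | n + 1, ⟨0, _⟩, X =>
    (α_ (F.obj (X 0)) (F.obj (X 1)) ((tensorPow F n).obj (fun j => X j.succ.succ))).symm ≪≫
      whiskerRightIso (Functor.Monoidal.μIso F (X 0) (X 1)) _
  | n + 1, ⟨i + 1, hi⟩, X =>
    whiskerLeftIso (F.obj (X 0)) (mergeIso (n := n) ⟨i, by omega⟩ (fun j => X j.succ))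

theorem mergeIso_naturality : ∀ {n : ℕ} (i : Fin n) {X Y : Fin (n + 1) → C} (φ : X ⟶ Y),
    (tensorPow F (n + 1)).map φ ≫ (mergeIso F i Y).hom =
      (mergeIso F i X).hom ≫ (tensorPow F n).map ((merge i).map φ)
  | n + 1, ⟨0, _⟩, X, Y, φ => by
    change (F.map (φ 0) ⊗ₘ (F.map (φ 1) ⊗ₘ (tensorPow F n).map (X := fun j => X j.succ.succ)
        (Y := fun j => Y j.succ.succ) (fun j => φ j.succ.succ))) ≫
        ((α_ _ _ _).inv ≫ Functor.LaxMonoidal.μ F (Y 0) (Y 1) ▷ _) =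
      ((α_ _ _ _).inv ≫ Functor.LaxMonoidal.μ F (X 0) (X 1) ▷ _) ≫
        (F.map (φ 0 ⊗ₘ φ 1) ⊗ₘ (tensorPow F n).map (X := fun j => X j.succ.succ)
        (Y := fun j => Y j.succ.succ) (fun j => φ j.succ.succ))
    rw [associator_inv_naturality_assoc, Category.assoc, ← tensorHom_id, ← tensorHom_id,
      tensorHom_comp_tensorHom, tensorHom_comp_tensorHom, Functor.LaxMonoidal.μ_natural]
    simp only [Category.comp_id, Category.id_comp]
  | n + 1, ⟨i + 1, hi⟩, X, Y, φ => by
    have ih := mergeIso_naturality (n := n) ⟨i, by omega⟩ (X := fun j => X j.succ)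
      (Y := fun j => Y j.succ) (fun j => φ j.succ)
    change (F.map (φ 0) ⊗ₘ (tensorPow F (n + 1)).map (X := fun j => X j.succ)
        (Y := fun j => Y j.succ) (fun j => φ j.succ)) ≫
        F.obj (Y 0) ◁ (mergeIso F (n := n) ⟨i, by omega⟩ (fun j => Y j.succ)).hom =
      F.obj (X 0) ◁ (mergeIso F (n := n) ⟨i, by omega⟩ (fun j => X j.succ)).hom ≫
        (F.map (φ 0) ⊗ₘ (tensorPow F n).map ((merge (n := n) ⟨i, by omega⟩).map
          (X := fun j => X j.succ) (Y := fun j => Y j.succ) (fun j => φ j.succ)))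
    rw [← id_tensorHom, ← id_tensorHom, tensorHom_comp_tensorHom, tensorHom_comp_tensorHom, ih]
    simp only [Category.comp_id, Category.id_comp]

variable {F}

/-- The iterated half-braiding
`U ⊗ F X₁ ⊗ ⋯ ⊗ F Xₙ ⟶ F X₁ ⊗ ⋯ ⊗ F Xₙ ⊗ U`, moving `U` past `F X₁`, …, `F Xₙ` in turn. -/
def iterBraid (U : Centralizer F) : (n : ℕ) → (X : Fin n → C) →
    (U.pt ⊗ (tensorPow F n).obj X ⟶ (tensorPow F n).obj X ⊗ U.pt)
  | 0, _ => (ρ_ U.pt).hom ≫ (λ_ U.pt).inv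
  | n + 1, X =>
    (α_ U.pt (F.obj (X 0)) ((tensorPow F n).obj (fun i => X i.succ))).inv ≫
      (U.braid.β (X 0)).hom ▷ (tensorPow F n).obj (fun i => X i.succ) ≫
        (α_ (F.obj (X 0)) U.pt ((tensorPow F n).obj (fun i => X i.succ))).hom ≫
          F.obj (X 0) ◁ iterBraid U n (fun i => X i.succ) ≫
            (α_ (F.obj (X 0)) ((tensorPow F n).obj (fun i => X i.succ)) U.pt).inv

theorem iterBraid_naturality (U : Centralizer F) : ∀ (n : ℕ) {X Y : Fin n → C} (φ : X ⟶ Y),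
    U.pt ◁ (tensorPow F n).map φ ≫ iterBraid U n Y =
      iterBraid U n X ≫ (tensorPow F n).map φ ▷ U.pt
  | 0, X, Y, φ => by
    change U.pt ◁ 𝟙 (𝟙_ D) ≫ (ρ_ U.pt).hom ≫ (λ_ U.pt).inv =
      ((ρ_ U.pt).hom ≫ (λ_ U.pt).inv) ≫ 𝟙 (𝟙_ D) ▷ U.pt
    simp
  | n + 1, X, Y, φ => by
    have ih := iterBraid_naturality U n (X := fun i => X i.succ) (Y := fun i => Y i.succ)
      (fun i => φ i.succ)
    have hb := U.braid.naturality (φ 0)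
    change U.pt ◁ (F.map (φ 0) ⊗ₘ (tensorPow F n).map (X := fun i => X i.succ)
        (Y := fun i => Y i.succ) (fun i => φ i.succ)) ≫
      ((α_ _ _ _).inv ≫ (U.braid.β (Y 0)).hom ▷ (tensorPow F n).obj (fun i => Y i.succ) ≫
        (α_ _ _ _).hom ≫ F.obj (Y 0) ◁ iterBraid U n (fun i => Y i.succ) ≫ (α_ _ _ _).inv) =
      ((α_ _ _ _).inv ≫ (U.braid.β (X 0)).hom ▷ (tensorPow F n).obj (fun i => X i.succ) ≫
        (α_ _ _ _).hom ≫ F.obj (X 0) ◁ iterBraid U n (fun i => X i.succ) ≫ (α_ _ _ _).inv) ≫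
      (F.map (φ 0) ⊗ₘ (tensorPow F n).map (X := fun i => X i.succ)
        (Y := fun i => Y i.succ) (fun i => φ i.succ)) ▷ U.pt
    generalize (tensorPow F n).map (X := fun i => X i.succ)
        (Y := fun i => Y i.succ) (fun i => φ i.succ) = q at *
    generalize iterBraid U n (fun i => X i.succ) = rX at *
    generalize iterBraid U n (fun i => Y i.succ) = rY at *
    generalize (tensorPow F n).obj (fun i => X i.succ) = P at *
    generalize (tensorPow F n).obj (fun i => Y i.succ) = Q at *
    rw [MonoidalCategory.tensorHom_def]
    calc
      _ = 𝟙 _ ⊗≫ (U.pt ◁ F.map (φ 0)) ▷ P ⊗≫ (((U.pt ⊗ F.obj (Y 0)) ◁ q) ≫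
            (U.braid.β (Y 0)).hom ▷ Q) ⊗≫ F.obj (Y 0) ◁ rY ⊗≫ 𝟙 _ := by monoidal
      _ = 𝟙 _ ⊗≫ (U.pt ◁ F.map (φ 0) ≫ (U.braid.β (Y 0)).hom) ▷ P ⊗≫
            F.obj (Y 0) ◁ (U.pt ◁ q ≫ rY) ⊗≫ 𝟙 _ := by
        rw [whisker_exchange]; monoidal
      _ = 𝟙 _ ⊗≫ (U.braid.β (X 0)).hom ▷ P ⊗≫
            (F.map (φ 0) ▷ (U.pt ⊗ P) ≫ F.obj (Y 0) ◁ rX) ⊗≫ F.obj (Y 0) ◁ q ▷ U.pt ⊗≫ 𝟙 _ := by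
        rw [hb, ih]; monoidal
      _ = _ := by rw [← whisker_exchange]; monoidal

variable (F) in
/-- The Davydov-Yetter cochains `C^n(F, U) = Nat(U ⊗ F^{⊗ n}, F^{⊗ n})`. -/
abbrev Cochain (U : Centralizer F) (n : ℕ) : Type (max u₁ v₂) :=
  tensorPow F n ⋙ tensorLeft U.pt ⟶ tensorPow F n

namespace Cochain

/-- The component `f_{X₁, …, Xₙ} : U ⊗ F X₁ ⊗ ⋯ ⊗ F Xₙ ⟶ F X₁ ⊗ ⋯ ⊗ F Xₙ` of a cochain. -/
def ev {U : Centralizer F} {n : ℕ} (f : Cochain F U n) (X : Fin n → C) :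
    U.pt ⊗ (tensorPow F n).obj X ⟶ (tensorPow F n).obj X :=
  f.app X

theorem ev_naturality {U : Centralizer F} {n : ℕ} (f : Cochain F U n) {X Y : Fin n → C}
    (φ : X ⟶ Y) :
    U.pt ◁ (tensorPow F n).map φ ≫ f.ev Y = f.ev X ≫ (tensorPow F n).map φ :=
  f.naturality φ

/-- A cochain from a natural family of components. -/
def ofFamily {U : Centralizer F} {n : ℕ}
    (f : ∀ X : Fin n → C, U.pt ⊗ (tensorPow F n).obj X ⟶ (tensorPow F n).obj X)
    (hf : ∀ {X Y : Fin n → C} (φ : X ⟶ Y),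
      U.pt ◁ (tensorPow F n).map φ ≫ f Y = f X ≫ (tensorPow F n).map φ) : Cochain F U n where
  app X := f X
  naturality _ _ φ := hf φ

theorem ev_ofFamily {U : Centralizer F} {n : ℕ}
    (f : ∀ X : Fin n → C, U.pt ⊗ (tensorPow F n).obj X ⟶ (tensorPow F n).obj X)
    (hf : ∀ {X Y : Fin n → C} (φ : X ⟶ Y),
      U.pt ◁ (tensorPow F n).map φ ≫ f Y = f X ≫ (tensorPow F n).map φ) (X : Fin n → C) :
    (ofFamily f hf).ev X = f X := rfl

theorem ext_ev {U : Centralizer F} {n : ℕ} {f g : Cochain F U n}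
    (h : ∀ X, f.ev X = g.ev X) : f = g :=
  NatTrans.ext (funext h)

end Cochain

/-- The summand `(F X₀ ⊗ f_{X₁, …, Xₙ}) ∘ (ρ(X₀) ⊗ F X₁ ⊗ ⋯ ⊗ F Xₙ)` of the differential. -/
def firstFace {U : Centralizer F} {n : ℕ} (f : Cochain F U n) : Cochain F U (n + 1) :=
  Cochain.ofFamily
    (fun X =>
      (α_ U.pt (F.obj (X 0)) ((tensorPow F n).obj (fun i => X i.succ))).inv ≫
        (U.braid.β (X 0)).hom ▷ (tensorPow F n).obj (fun i => X i.succ) ≫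
          (α_ (F.obj (X 0)) U.pt ((tensorPow F n).obj (fun i => X i.succ))).hom ≫
            F.obj (X 0) ◁ f.ev (fun i => X i.succ))
    (fun {X Y} φ => by
      have hf := f.ev_naturality (X := fun i => X i.succ) (Y := fun i => Y i.succ)
        (fun i => φ i.succ)
      have hb := U.braid.naturality (φ 0)
      change U.pt ◁ (F.map (φ 0) ⊗ₘ (tensorPow F n).map (X := fun i => X i.succ)
          (Y := fun i => Y i.succ) (fun i => φ i.succ)) ≫
        ((α_ _ _ _).inv ≫ (U.braid.β (Y 0)).hom ▷ (tensorPow F n).obj (fun i => Y i.succ) ≫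
          (α_ _ _ _).hom ≫ F.obj (Y 0) ◁ f.ev (fun i => Y i.succ)) =
        ((α_ _ _ _).inv ≫ (U.braid.β (X 0)).hom ▷ (tensorPow F n).obj (fun i => X i.succ) ≫
          (α_ _ _ _).hom ≫ F.obj (X 0) ◁ f.ev (fun i => X i.succ)) ≫
        (F.map (φ 0) ⊗ₘ (tensorPow F n).map (X := fun i => X i.succ)
          (Y := fun i => Y i.succ) (fun i => φ i.succ))
      generalize (tensorPow F n).map (X := fun i => X i.succ)
          (Y := fun i => Y i.succ) (fun i => φ i.succ) = q at *
      generalize f.ev (fun i => X i.succ) = rX at *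
      generalize f.ev (fun i => Y i.succ) = rY at *
      generalize (tensorPow F n).obj (fun i => X i.succ) = P at *
      generalize (tensorPow F n).obj (fun i => Y i.succ) = Q at *
      rw [MonoidalCategory.tensorHom_def]
      calc
        _ = 𝟙 _ ⊗≫ (U.pt ◁ F.map (φ 0)) ▷ P ⊗≫ (((U.pt ⊗ F.obj (Y 0)) ◁ q) ≫
              (U.braid.β (Y 0)).hom ▷ Q) ⊗≫ F.obj (Y 0) ◁ rY ⊗≫ 𝟙 _ := by monoidal
        _ = 𝟙 _ ⊗≫ (U.pt ◁ F.map (φ 0) ≫ (U.braid.β (Y 0)).hom) ▷ P ⊗≫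
              F.obj (Y 0) ◁ (U.pt ◁ q ≫ rY) ⊗≫ 𝟙 _ := by
          rw [whisker_exchange]; monoidal
        _ = 𝟙 _ ⊗≫ (U.braid.β (X 0)).hom ▷ P ⊗≫
              (F.map (φ 0) ▷ (U.pt ⊗ P) ≫ F.obj (Y 0) ◁ rX) ⊗≫ F.obj (Y 0) ◁ q ⊗≫ 𝟙 _ := by
          rw [hb, hf]; monoidal
        _ = _ := by rw [← whisker_exchange]; monoidal)

theorem firstFace_ev {U : Centralizer F} {n : ℕ} (f : Cochain F U n) (X : Fin (n + 1) → C) :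
    (firstFace f).ev X =
      (α_ U.pt (F.obj (X 0)) ((tensorPow F n).obj (fun i => X i.succ))).inv ≫
        (U.braid.β (X 0)).hom ▷ (tensorPow F n).obj (fun i => X i.succ) ≫
          (α_ (F.obj (X 0)) U.pt ((tensorPow F n).obj (fun i => X i.succ))).hom ≫
            F.obj (X 0) ◁ f.ev (fun i => X i.succ) := rfl

/-- The summand `f_{X₀, …, Xᵢ ⊗ Xᵢ₊₁, …, Xₙ}` of the differential. -/
def innerFace {U : Centralizer F} {n : ℕ} (i : Fin n) (f : Cochain F U n) :
    Cochain F U (n + 1) :=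
  Cochain.ofFamily
    (fun X => U.pt ◁ (mergeIso F i X).hom ≫ f.ev ((merge i).obj X) ≫ (mergeIso F i X).inv)
    (fun {X Y} φ => by
      have hm := mergeIso_naturality F i φ
      have hm' : (mergeIso F i X).inv ≫ (tensorPow F (n + 1)).map φ =
          (tensorPow F n).map ((merge i).map φ) ≫ (mergeIso F i Y).inv := by
        rw [Iso.inv_comp_eq, ← Category.assoc, Iso.eq_comp_inv, hm]
      simp only [Category.assoc]
      rw [← MonoidalCategory.whiskerLeft_comp_assoc, hm,
        MonoidalCategory.whiskerLeft_comp_assoc, hm', ← Category.assoc (f.ev _),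
        ← f.ev_naturality, Category.assoc])

theorem innerFace_ev {U : Centralizer F} {n : ℕ} (i : Fin n) (f : Cochain F U n)
    (X : Fin (n + 1) → C) :
    (innerFace i f).ev X =
      U.pt ◁ (mergeIso F i X).hom ≫ f.ev ((merge i).obj X) ≫ (mergeIso F i X).inv := rfl

/-- The summand `f_{X₀, …, Xₙ₋₁} ⊗ F Xₙ` of the differential; the one-fold tensor power
`F Xₙ ⊗ 𝟙` stands for `F Xₙ` here. -/
def lastFace {U : Centralizer F} {n : ℕ} (f : Cochain F U n) : Cochain F U (n + 1) :=
  Cochain.ofFamily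
    (fun X =>
      U.pt ◁ (split F (m := n) (n := 1) rfl X).hom ≫
        (α_ U.pt ((tensorPow F n).obj ((front rfl).obj X))
          ((tensorPow F 1).obj ((back rfl).obj X))).inv ≫
        f.ev ((front rfl).obj X) ▷ (tensorPow F 1).obj ((back rfl).obj X) ≫
          (split F (m := n) (n := 1) rfl X).inv)
    (fun {X Y} φ => by
      have hf := f.ev_naturality ((front (m := n) (n := 1) rfl).map φ)
      simp only [Category.assoc]
      rw [split_inv_naturality, ← MonoidalCategory.whiskerLeft_comp_assoc, split_naturality,
        MonoidalCategory.whiskerLeft_comp_assoc]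
      congr 1
      rw [← id_tensorHom, associator_inv_naturality_assoc, ← tensorHom_id, ← tensorHom_id,
        tensorHom_comp_tensorHom_assoc, tensorHom_comp_tensorHom_assoc, id_tensorHom, hf]
      simp only [Category.comp_id, Category.id_comp])

theorem lastFace_ev {U : Centralizer F} {n : ℕ} (f : Cochain F U n) (X : Fin (n + 1) → C) :
    (lastFace f).ev X =
      U.pt ◁ (split F (m := n) (n := 1) rfl X).hom ≫
        (α_ U.pt ((tensorPow F n).obj ((front rfl).obj X))
          ((tensorPow F 1).obj ((back rfl).obj X))).inv ≫
        f.ev ((front rfl).obj X) ▷ (tensorPow F 1).obj ((back rfl).obj X) ≫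
          (split F (m := n) (n := 1) rfl X).inv := rfl

/-- The comultiplication of a coalgebra object of the centralizer, as a morphism of `D`. -/
def comulHom (U : Centralizer F) [ComonObj U] : U.pt ⟶ U.pt ⊗ U.pt :=
  (ComonObj.comul (X := U)).f

/-- The counit of a coalgebra object of the centralizer, as a morphism of `D`. -/
def counitHom (U : Centralizer F) [ComonObj U] : U.pt ⟶ 𝟙_ D :=
  (ComonObj.counit (X := U)).f

/-- The cup product `f ∪ g` of cochains of degrees `m` and `n`, in degree `N = m + n`:
`(f_{X₁, …, Xₘ} ⊗ g_{Xₘ₊₁, …, X_N}) ∘ (U ⊗ ρ(X₁, …, Xₘ) ⊗ F Xₘ₊₁ ⊗ ⋯) ∘ (Δ ⊗ F X₁ ⊗ ⋯)`. -/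
def cup (U : Centralizer F) [ComonObj U] {m n N : ℕ} (h : m + n = N)
    (f : Cochain F U m) (g : Cochain F U n) : Cochain F U N :=
  Cochain.ofFamily
    (fun X =>
      U.pt ◁ (split F h X).hom ≫
        comulHom U ▷ ((tensorPow F m).obj ((front h).obj X) ⊗
            (tensorPow F n).obj ((back h).obj X)) ≫
          (α_ U.pt U.pt _).hom ≫
            U.pt ◁ ((α_ U.pt _ _).inv ≫
              iterBraid U m ((front h).obj X) ▷ (tensorPow F n).obj ((back h).obj X) ≫
                (α_ _ U.pt _).hom) ≫
              (α_ U.pt _ (U.pt ⊗ _)).inv ≫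
                (f.ev ((front h).obj X) ⊗ₘ g.ev ((back h).obj X)) ≫
                  (split F h X).inv)
    (fun {X Y} φ => by
      have hf := f.ev_naturality ((front h).map φ)
      have hg := g.ev_naturality ((back h).map φ)
      have hb := iterBraid_naturality U m ((front h).map φ)
      simp only [Category.assoc]
      rw [split_inv_naturality, ← MonoidalCategory.whiskerLeft_comp_assoc, split_naturality,
        MonoidalCategory.whiskerLeft_comp_assoc]
      congr 1
      simp only [← Category.assoc]
      congr 1
      generalize iterBraid U m ((front h).obj X) = bX at *
      generalize iterBraid U m ((front h).obj Y) = bY at *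
      generalize f.ev ((front h).obj X) = fX at *
      generalize f.ev ((front h).obj Y) = fY at *
      generalize g.ev ((back h).obj X) = gX at *
      generalize g.ev ((back h).obj Y) = gY at *
      generalize (tensorPow F m).map ((front h).map φ) = p at *
      generalize (tensorPow F n).map ((back h).map φ) = q at *
      generalize (tensorPow F m).obj ((front h).obj X) = P at *
      generalize (tensorPow F m).obj ((front h).obj Y) = P' at *
      generalize (tensorPow F n).obj ((back h).obj X) = Q at *
      generalize (tensorPow F n).obj ((back h).obj Y) = Q' at *
      generalize comulHom U = Δ at *
      have e1 : U.pt ◁ (p ⊗ₘ q) ≫ Δ ▷ (P' ⊗ Q') = Δ ▷ (P ⊗ Q) ≫ (U.pt ⊗ U.pt) ◁ (p ⊗ₘ q) :=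
        whisker_exchange _ _
      have e2 : (p ▷ U.pt ⊗ₘ q) ≫ (α_ P' U.pt Q').hom =
          (α_ P U.pt Q).hom ≫ (p ⊗ₘ (U.pt ◁ q)) := by
        rw [← tensorHom_id, ← id_tensorHom, associator_naturality]
      have e3 : U.pt ◁ (p ⊗ₘ q) ≫ (α_ U.pt P' Q').inv ≫ bY ▷ Q' ≫ (α_ P' U.pt Q').hom =
          ((α_ U.pt P Q).inv ≫ bX ▷ Q ≫ (α_ P U.pt Q).hom) ≫ (p ⊗ₘ (U.pt ◁ q)) := by
        rw [← id_tensorHom, associator_inv_naturality_assoc, ← tensorHom_id bY,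
          tensorHom_comp_tensorHom_assoc, id_tensorHom, hb, Category.comp_id]
        simp only [Category.assoc]
        rw [← e2, ← tensorHom_id bX, tensorHom_comp_tensorHom_assoc, Category.id_comp]
      have e4 : U.pt ◁ (p ⊗ₘ (U.pt ◁ q)) ≫ (α_ U.pt P' (U.pt ⊗ Q')).inv ≫ (fY ⊗ₘ gY) =
          (α_ U.pt P (U.pt ⊗ Q)).inv ≫ (fX ⊗ₘ gX) ≫ (p ⊗ₘ q) := by
        rw [← id_tensorHom U.pt (p ⊗ₘ _), associator_inv_naturality_assoc,
          tensorHom_comp_tensorHom, tensorHom_comp_tensorHom, id_tensorHom, hf, hg]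
      rw [e1]
      simp only [Category.assoc]
      congr 1
      rw [tensor_whiskerLeft]
      simp only [Category.assoc, Iso.inv_hom_id_assoc]
      congr 1
      rw [← MonoidalCategory.whiskerLeft_comp_assoc, e3,
        MonoidalCategory.whiskerLeft_comp_assoc, e4])

/-- The second cup product `f ⊔ g`: comultiply, apply `U ⊗ f_{X₁, …, Xₘ} ⊗ F Xₘ₊₁ ⊗ ⋯`, move the
remaining `U` past `F X₁, …, F Xₘ`, and apply `F X₁ ⊗ ⋯ ⊗ F Xₘ ⊗ g_{Xₘ₊₁, …, X_N}`. -/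
def sqcup (U : Centralizer F) [ComonObj U] {m n N : ℕ} (h : m + n = N)
    (f : Cochain F U m) (g : Cochain F U n) : Cochain F U N :=
  Cochain.ofFamily
    (fun X =>
      U.pt ◁ (split F h X).hom ≫
        comulHom U ▷ ((tensorPow F m).obj ((front h).obj X) ⊗
            (tensorPow F n).obj ((back h).obj X)) ≫
          (α_ U.pt U.pt _).hom ≫
            U.pt ◁ ((α_ U.pt _ _).inv ≫
              f.ev ((front h).obj X) ▷ (tensorPow F n).obj ((back h).obj X)) ≫
              (α_ U.pt _ _).inv ≫
                iterBraid U m ((front h).obj X) ▷ (tensorPow F n).obj ((back h).obj X) ≫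
                  (α_ _ U.pt _).hom ≫
                    (tensorPow F m).obj ((front h).obj X) ◁ g.ev ((back h).obj X) ≫
                      (split F h X).inv)
    (fun {X Y} φ => by
      have hf := f.ev_naturality ((front h).map φ)
      have hg := g.ev_naturality ((back h).map φ)
      have hb := iterBraid_naturality U m ((front h).map φ)
      simp only [Category.assoc]
      rw [split_inv_naturality, ← MonoidalCategory.whiskerLeft_comp_assoc, split_naturality,
        MonoidalCategory.whiskerLeft_comp_assoc]
      congr 1
      simp only [← Category.assoc]
      congr 1
      generalize iterBraid U m ((front h).obj X) = bX at *
      generalize iterBraid U m ((front h).obj Y) = bY at *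
      generalize f.ev ((front h).obj X) = fX at *
      generalize f.ev ((front h).obj Y) = fY at *
      generalize g.ev ((back h).obj X) = gX at *
      generalize g.ev ((back h).obj Y) = gY at *
      generalize (tensorPow F m).map ((front h).map φ) = p at *
      generalize (tensorPow F n).map ((back h).map φ) = q at *
      generalize (tensorPow F m).obj ((front h).obj X) = P at *
      generalize (tensorPow F m).obj ((front h).obj Y) = P' at *
      generalize (tensorPow F n).obj ((back h).obj X) = Q at *
      generalize (tensorPow F n).obj ((back h).obj Y) = Q' at *
      generalize comulHom U = Δ at *
      have e1 : U.pt ◁ (p ⊗ₘ q) ≫ Δ ▷ (P' ⊗ Q') = Δ ▷ (P ⊗ Q) ≫ (U.pt ⊗ U.pt) ◁ (p ⊗ₘ q) :=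
        whisker_exchange _ _
      have e2 : U.pt ◁ (p ⊗ₘ q) ≫ (α_ U.pt P' Q').inv ≫ fY ▷ Q' =
          ((α_ U.pt P Q).inv ≫ fX ▷ Q) ≫ (p ⊗ₘ q) := by
        rw [← id_tensorHom, associator_inv_naturality_assoc, ← tensorHom_id fY,
          tensorHom_comp_tensorHom, id_tensorHom, hf, Category.comp_id]
        simp only [Category.assoc]
        rw [← tensorHom_id fX, tensorHom_comp_tensorHom, Category.id_comp]
      have e3 : U.pt ◁ (p ⊗ₘ q) ≫ (α_ U.pt P' Q').inv ≫ bY ▷ Q' ≫ (α_ P' U.pt Q').hom =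
          (α_ U.pt P Q).inv ≫ bX ▷ Q ≫ (α_ P U.pt Q).hom ≫ (p ⊗ₘ (U.pt ◁ q)) := by
        rw [← id_tensorHom, associator_inv_naturality_assoc, ← tensorHom_id bY,
          tensorHom_comp_tensorHom_assoc, id_tensorHom, hb, Category.comp_id,
          ← id_tensorHom U.pt q, ← associator_naturality, ← tensorHom_id bX,
          tensorHom_comp_tensorHom_assoc, Category.id_comp, tensorHom_id]
      have e4 : (p ⊗ₘ (U.pt ◁ q)) ≫ P' ◁ gY = P ◁ gX ≫ (p ⊗ₘ q) := by
        rw [← id_tensorHom P' gY, ← id_tensorHom P gX, tensorHom_comp_tensorHom,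
          tensorHom_comp_tensorHom, hg, Category.comp_id, Category.id_comp]
      rw [e1]
      simp only [Category.assoc]
      congr 1
      rw [tensor_whiskerLeft]
      simp only [Category.assoc, Iso.inv_hom_id_assoc]
      congr 1
      rw [← MonoidalCategory.whiskerLeft_comp_assoc, e2,
        MonoidalCategory.whiskerLeft_comp_assoc]
      congr 1
      rw [reassoc_of% e3, e4])

/-- The unit cochain, the counit of `U` in degree `0`. -/
def unitCochain (U : Centralizer F) [ComonObj U] : Cochain F U 0 :=
  Cochain.ofFamily (fun _ => (ρ_ U.pt).hom ≫ counitHom U) (fun {X Y} φ => by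
    change U.pt ◁ 𝟙 (𝟙_ D) ≫ (ρ_ U.pt).hom ≫ counitHom U =
      ((ρ_ U.pt).hom ≫ counitHom U) ≫ 𝟙 (𝟙_ D)
    simp)

theorem Cochain.ev_add [Preadditive D] {U : Centralizer F} {n : ℕ} (f g : Cochain F U n)
    (X : Fin n → C) : (f + g).ev X = f.ev X + g.ev X := rfl

theorem Cochain.ev_smul {k : Type w} [Field k] [Preadditive D] [Linear k D] {U : Centralizer F}
    {n : ℕ} (c : k) (f : Cochain F U n) (X : Fin n → C) : (c • f).ev X = c • f.ev X := rfl

end Complex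

section Cohomology

variable (k : Type w) [Field k]
variable {C : Type u₁} [Category.{v₁} C] [MonoidalCategory C]
variable {D : Type u₂} [Category.{v₂} D] [MonoidalCategory D]
  [Preadditive D] [Linear k D] [MonoidalPreadditive D] [MonoidalLinear k D]
variable {F : C ⥤ D} [F.Monoidal] (U : Centralizer F)

section

variable {k U} {n : ℕ}

theorem firstFace_add (f g : Cochain F U n) :
    firstFace (f + g) = firstFace f + firstFace g :=
  Cochain.ext_ev fun X => by
    simp only [Cochain.ev_add, firstFace_ev, MonoidalPreadditive.whiskerLeft_add, Preadditive.comp_add]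
    rfl

theorem firstFace_smul (c : k) (f : Cochain F U n) :
    firstFace (c • f) = c • firstFace f :=
  Cochain.ext_ev fun X => by
    simp only [Cochain.ev_smul, firstFace_ev, MonoidalLinear.whiskerLeft_smul, Linear.comp_smul]
    rfl

set_option linter.unusedSectionVars false in
theorem innerFace_add (i : Fin n) (f g : Cochain F U n) :
    innerFace i (f + g) = innerFace i f + innerFace i g :=
  Cochain.ext_ev fun X => by
    simp only [Cochain.ev_add, innerFace_ev, Preadditive.comp_add,
      Preadditive.add_comp]

set_option linter.unusedSectionVars false in
theorem innerFace_smul (i : Fin n) (c : k) (f : Cochain F U n) :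
    innerFace i (c • f) = c • innerFace i f :=
  Cochain.ext_ev fun X => by
    simp only [Cochain.ev_smul, innerFace_ev, Linear.comp_smul, Linear.smul_comp]

theorem lastFace_add (f g : Cochain F U n) :
    lastFace (f + g) = lastFace f + lastFace g :=
  Cochain.ext_ev fun X => by
    simp only [Cochain.ev_add, lastFace_ev, MonoidalPreadditive.add_whiskerRight, Preadditive.comp_add,
      Preadditive.add_comp]

theorem lastFace_smul (c : k) (f : Cochain F U n) :
    lastFace (c • f) = c • lastFace f :=
  Cochain.ext_ev fun X => by
    simp only [Cochain.ev_smul, lastFace_ev, MonoidalLinear.smul_whiskerRight, Linear.comp_smul,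
      Linear.smul_comp]

end

/-- The Davydov-Yetter differential `δⁿ : C^n(F, U) → C^{n+1}(F, U)`,
`δⁿ(f)_{X₀, …, Xₙ} = (F X₀ ⊗ f_{X₁, …, Xₙ}) ∘ (ρ(X₀) ⊗ F X₁ ⊗ ⋯ ⊗ F Xₙ)
  + ∑_{1 ≤ j ≤ n} (-1)^j f_{X₀, …, X_{j-1} ⊗ X_j, …, Xₙ} + (-1)^{n+1} f_{X₀, …, Xₙ₋₁} ⊗ F Xₙ`;
the index `i` below is `j - 1`. -/
def differential (n : ℕ) : Cochain F U n →ₗ[k] Cochain F U (n + 1) where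
  toFun f := firstFace f + ∑ i : Fin n, (-1 : ℤ) ^ (i.val + 1) • innerFace i f +
    (-1 : ℤ) ^ (n + 1) • lastFace f
  map_add' f g := by
    simp only [firstFace_add, innerFace_add, lastFace_add, smul_add, Finset.sum_add_distrib]
    abel
  map_smul' c f := by
    simp only [firstFace_smul, innerFace_smul, lastFace_smul, smul_add, Finset.smul_sum,
      RingHom.id_apply]
    congr 1
    · congr 1
      exact Finset.sum_congr rfl fun i _ => smul_comm _ _ _
    · exact smul_comm _ _ _

/-- The cocycles of degree `n`. -/
abbrev cocycles (n : ℕ) : Submodule k (Cochain F U n) :=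
  LinearMap.ker (differential k U n)

/-- The coboundaries of degree `n`. -/
def coboundaries : (n : ℕ) → Submodule k (Cochain F U n)
  | 0 => ⊥
  | n + 1 => LinearMap.range (differential k U n)

/-- The Davydov-Yetter cohomology `Hⁿ(F, U)`: cocycles modulo coboundaries. -/
abbrev Cohomology (n : ℕ) : Type (max u₁ v₂) :=
  cocycles k U n ⧸ (coboundaries k U n).submoduleOf (cocycles k U n)

/-- The cohomology class of a cocycle. -/
abbrev cohomologyClass (n : ℕ) : cocycles k U n →ₗ[k] Cohomology k U n :=
  ((coboundaries k U n).submoduleOf (cocycles k U n)).mkQ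

end Cohomology

/-- The structure of a graded associative unital `k`-algebra on a family `A 0, A 1, A 2, …` of
`k`-modules. Laws relating elements of `A p` and `A q` for provably equal `p`, `q` are stated in
`⨁ n, A n`. -/
structure GradedAlgebraStructure (k : Type*) [Field k] (A : ℕ → Type*)
    [∀ n, AddCommGroup (A n)] [∀ n, Module k (A n)] where
  /-- The product, a bilinear map of degree `0`. -/
  mul : ∀ m n : ℕ, A m →ₗ[k] A n →ₗ[k] A (m + n)
  /-- The unit. -/
  one : A 0
  mul_assoc : ∀ {m n p : ℕ} (a : A m) (b : A n) (c : A p),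
    DirectSum.of A (m + n + p) (mul (m + n) p (mul m n a b) c) =
      DirectSum.of A (m + (n + p)) (mul m (n + p) a (mul n p b c))
  one_mul : ∀ {n : ℕ} (a : A n), DirectSum.of A (0 + n) (mul 0 n one a) = DirectSum.of A n a
  mul_one : ∀ {n : ℕ} (a : A n), DirectSum.of A (n + 0) (mul n 0 a one) = DirectSum.of A n a

end DavydovYetter

end

/-! Cochains of a fixed degree form a ring under convolution: for `a, b : U ⊗ P ⟶ P` with `P =
F^{⊗n}(X₁, …, Xₙ)`, the product is `a ∘ (U ⊗ b) ∘ (Δ ⊗ P)`, associative because `Δ` is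
coassociative. The summands of the differential, without signs, are coface operators `D₀, …, Dₙ₊₁`.
Each is multiplicative: `D₀` because `Δ` is a morphism of the centralizer, the others because they
only conjugate by isomorphisms or tensor with an identity. The cosimplicial identities come from
monoidality of the half-braiding, associativity of `μ` and naturality of cochains.

Extending `f` by the identity of the last `n` factors iterates the last coface; moving `U` past the
first `m` factors before applying `g` iterates the first. Hence, for degrees `m` and `n`, `f ∪ g =
D_{m+1}^n f * D_0^m g`, an Alexander-Whitney product, and `f ⊔ g` has the same two factors in the
opposite order (`cup_eq_conv`, `sqcup_eq_conv`). So `⊔` is `∪` for the opposite convolution, and the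
Leibniz rule and associativity, proved once for any system of cofaces on a ring (`delta_cup`,
`cup_assoc` in `CofaceSystem`), serve both products.

Part (b) is Steenrod's cup-one argument, in the shape of Gerstenhaber's proof for Hochschild
cochains. For `g` of degree `n + 1`, let `f ∘ᵢ g = D_{i+1}^n f * D_{n+i+2}^s D_0^i g` be the
insertion of `g` in position `i` of `f`, where `f` has degree `i + 1 + s`. For cocycles, the
coboundary of `f ∘ᵢ g` is a difference of consecutive terms up to sign (`delta_insertion`); a signed
sum over `i` telescopes, and its two ends are `f ∪ g` and `g ⊔ f` (`exists_delta_eq`). If `g` has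
degree `0`, the cocycle condition is `D₀ g = D₁ g` and the two products already agree on cochains.

To keep the formal computation free of dependent degrees, all cochain rings are put into the single
product ring `∀ n, Cochain F U n`, on which each `D j` acts by raising the degree. -/

noncomputable section

universe w v₁ v₂ u₁ u₂

namespace DavydovYetter

/-! ### Formal cosimplicial algebra: Leibniz rule, associativity and the cup-one homotopy. -/

section Semicosimplicial

variable {R : Type*} [NonUnitalRing R]

/-- A family of endomorphisms `D j` of a non-unital ring `R` satisfying the cosimplicial
identities. A semicosimplicial ring `A 0, A 1, …` gives such a family on `∀ n, A n`. -/
structure CofaceSystem (R : Type*) [NonUnitalRing R] where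
  /-- The coface operators. -/
  D : ℕ → R →ₙ+* R
  comm' : ∀ {i j : ℕ}, i ≤ j → ∀ x : R, D (j + 1) (D i x) = D i (D j x)

namespace CofaceSystem

variable (S : CofaceSystem R)

/-- The `r`-fold iterate of the coface operator `D a`. -/
def pow (a r : ℕ) : R → R := (S.D a)^[r]

@[simp]
theorem pow_zero (a : ℕ) (x : R) : S.pow a 0 x = x := rfl

theorem pow_succ (a r : ℕ) (x : R) : S.pow a (r + 1) x = S.pow a r (S.D a x) := rfl

theorem pow_succ' (a r : ℕ) (x : R) : S.pow a (r + 1) x = S.D a (S.pow a r x) :=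
  Function.iterate_succ_apply' _ _ _

theorem pow_add (a r s : ℕ) (x : R) : S.pow a (r + s) x = S.pow a r (S.pow a s x) :=
  Function.iterate_add_apply _ _ _ _

theorem pow_mul_apply (a r : ℕ) (x y : R) : S.pow a r (x * y) = S.pow a r x * S.pow a r y := by
  induction r with
  | zero => rfl
  | succ r ih => simp only [pow_succ', ih, map_mul]

theorem pow_zsmul (a r : ℕ) (c : ℤ) (x : R) : S.pow a r (c • x) = c • S.pow a r x := by
  induction r with
  | zero => rfl
  | succ r ih => simp only [pow_succ', ih, map_zsmul]

theorem pow_sum {ι : Type*} (a r : ℕ) (s : Finset ι) (f : ι → R) :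
    S.pow a r (∑ i ∈ s, f i) = ∑ i ∈ s, S.pow a r (f i) := by
  induction r with
  | zero => rfl
  | succ r ih => simp only [pow_succ', ih, map_sum]

theorem pow_map_zero (a r : ℕ) : S.pow a r 0 = 0 := by
  induction r with
  | zero => rfl
  | succ r ih => simp only [pow_succ', ih, map_zero]

theorem D_pow_of_le {j a : ℕ} (h : j ≤ a) (r : ℕ) (x : R) :
    S.D j (S.pow a r x) = S.pow (a + 1) r (S.D j x) := by
  induction r with
  | zero => rfl
  | succ r ih => rw [pow_succ', pow_succ', ← ih, S.comm' h]

theorem D_pow_of_ge {j a r : ℕ} (h : a + r ≤ j + r) (x : R) :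
    S.D (j + r) (S.pow a r x) = S.pow a r (S.D j x) := by
  induction r generalizing j with
  | zero => rfl
  | succ r ih =>
    rw [pow_succ', pow_succ', ← ih (by omega), ← add_assoc, S.comm' (by omega)]

/-- The operators `D a, …, D (a + r)` all agree on an `r`-fold image of `D a`. This is why a fixed
index `m + 1` can be used in `cup`, although the index of the last coface grows with the degree. -/
theorem D_pow_mid {j a r : ℕ} (h : a ≤ j) (h' : j ≤ a + r) (x : R) :
    S.D j (S.pow a r x) = S.pow a (r + 1) x := by
  obtain ⟨t, rfl⟩ := Nat.exists_eq_add_of_le h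
  obtain ⟨s, rfl⟩ := Nat.exists_eq_add_of_le (show t ≤ r by omega)
  rw [add_comm t s, show s + t + 1 = t + 1 + s by omega, add_comm s t, pow_add, pow_add _ _ (t + 1),
    S.D_pow_of_ge (by omega), ← pow_succ]

theorem pow_succ_D (a r : ℕ) (x : R) : S.pow (a + 1) r (S.D a x) = S.pow a (r + 1) x := by
  rw [← S.D_pow_of_le le_rfl, ← pow_succ']

theorem pow_pow_of_le {a b : ℕ} (h : b ≤ a) (r s : ℕ) (x : R) :
    S.pow b s (S.pow a r x) = S.pow (a + s) r (S.pow b s x) := by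
  induction s with
  | zero => rfl
  | succ s ih => rw [pow_succ', pow_succ', ih, S.D_pow_of_le (by omega)]; rfl

theorem pow_succ_pow (a r s : ℕ) (x : R) :
    S.pow (a + s) r (S.pow a s x) = S.pow a (r + s) x := by
  rw [← S.pow_pow_of_le le_rfl, ← pow_add, add_comm]

/-- The alternating sum of the first `n + 2` coface operators. -/
def delta (n : ℕ) (x : R) : R := ∑ j ∈ Finset.range (n + 2), (-1 : ℤ) ^ j • S.D j x

theorem delta_delta (n : ℕ) (x : R) : S.delta (n + 1) (S.delta n x) = 0 := by
  simp only [delta, map_sum, map_zsmul, Finset.smul_sum, smul_smul, ← _root_.pow_add]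
  rw [← Finset.sum_product' (f := fun j i => (-1 : ℤ) ^ (j + i) • S.D j (S.D i x))]
  -- The cosimplicial identity pairs `(j, i)`, for `i < j`, with `(i, j - 1)`; the sums of indices
  -- differ by one, so the signs are opposite.
  refine Finset.sum_involution
    (fun p _ => if p.2 < p.1 then (p.2, p.1 - 1) else (p.2 + 1, p.1)) ?_ ?_ ?_ ?_
  · rintro ⟨j, i⟩ -
    by_cases h : i < j
    · obtain ⟨j, rfl⟩ : ∃ l, j = l + 1 := ⟨j - 1, by omega⟩
      simp only [h, if_true, Nat.add_sub_cancel]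
      rw [S.comm' (by omega), show j + 1 + i = (i + j) + 1 by omega, _root_.pow_succ]
      simp
    · simp only [h, if_false]
      rw [S.comm' (by omega), show i + 1 + j = (j + i) + 1 by omega, _root_.pow_succ]
      simp
  · rintro ⟨j, i⟩ - -
    by_cases h : i < j
    · simp only [h, if_true, ne_eq, Prod.mk.injEq]; omega
    · simp only [h, if_false, ne_eq, Prod.mk.injEq]; omega
  · rintro ⟨j, i⟩ hp
    simp only [Finset.mem_product, Finset.mem_range] at hp ⊢
    by_cases h : i < j
    · simp only [h, if_true]; omega
    · simp only [h, if_false]; omega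
  · rintro ⟨j, i⟩ -
    by_cases h : i < j
    · have : ¬ (j - 1 < i) := by omega
      simp only [h, if_true, this, if_false]
      rw [Nat.sub_add_cancel (by omega)]
    · have : j < i + 1 := by omega
      simp only [h, if_false, this, if_true, Nat.add_sub_cancel]

/-- The Alexander-Whitney product of an element of degree `m` and one of degree `n`. -/
def cup (m n : ℕ) (f g : R) : R := S.pow (m + 1) n f * S.pow 0 m g

theorem cup_assoc (m n p : ℕ) (f g h : R) :
    S.cup (m + n) p (S.cup m n f g) h = S.cup m (n + p) f (S.cup n p g h) := by
  simp only [cup, pow_mul_apply, mul_assoc]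
  rw [show m + n + 1 = m + 1 + n by omega, S.pow_succ_pow, add_comm p n,
    S.pow_pow_of_le (Nat.zero_le _) p m g, ← pow_add,
    show m + 1 + n = n + 1 + m by omega]

theorem D_cup_of_le {m n j : ℕ} (h : j ≤ m) (f g : R) :
    S.D j (S.cup m n f g) = S.cup (m + 1) n (S.D j f) g := by
  rw [cup, cup, map_mul, S.D_pow_of_le (by omega), S.D_pow_mid (by omega) (by omega)]

theorem D_cup_of_gt {m n j : ℕ} (h : 1 ≤ j) (h' : j ≤ n + 1) (f g : R) :
    S.D (m + j) (S.cup m n f g) = S.cup m (n + 1) f (S.D j g) := by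
  rw [cup, cup, map_mul, S.D_pow_mid (by omega) (by omega), add_comm m j,
    S.D_pow_of_ge (by omega)]

/-- These are the two terms of the Leibniz rule that are not cofaces of the product. They coincide
and enter with opposite signs, so they cancel. -/
theorem D_last_cup (m n : ℕ) (f g : R) :
    S.cup (m + 1) n (S.D (m + 1) f) g = S.cup m (n + 1) f (S.D 0 g) := by
  rw [cup, cup, S.pow_succ_D, ← S.pow_succ]

theorem sum_cup {ι : Type*} (m n : ℕ) (s : Finset ι) (c : ι → ℤ) (f : ι → R) (g : R) :
    S.cup m n (∑ i ∈ s, c i • f i) g = ∑ i ∈ s, c i • S.cup m n (f i) g := by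
  simp only [cup, pow_sum, pow_zsmul, Finset.sum_mul, smul_mul_assoc]

theorem cup_sum {ι : Type*} (m n : ℕ) (s : Finset ι) (c : ι → ℤ) (f : R) (g : ι → R) :
    S.cup m n f (∑ i ∈ s, c i • g i) = ∑ i ∈ s, c i • S.cup m n f (g i) := by
  simp only [cup, pow_sum, pow_zsmul, Finset.mul_sum, mul_smul_comm]

/-- The graded Leibniz rule. -/
theorem delta_cup (m n : ℕ) (f g : R) :
    S.delta (m + n) (S.cup m n f g) =
      S.cup (m + 1) n (S.delta m f) g + (-1 : ℤ) ^ m • S.cup m (n + 1) f (S.delta n g) := by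
  -- The cofaces of the product with index at most `m` act on `f`, those with index above `m` act on
  -- `g` through its cofaces of positive index. Each side leaves one extra term.
  have h1 : S.cup (m + 1) n (S.delta m f) g = ∑ j ∈ Finset.range (m + 1),
      (-1 : ℤ) ^ j • S.D j (S.cup m n f g) +
        (-1 : ℤ) ^ (m + 1) • S.cup m (n + 1) f (S.D 0 g) := by
    rw [delta, sum_cup, Finset.sum_range_succ, D_last_cup]
    congr 1
    refine Finset.sum_congr rfl fun j hj => ?_
    rw [S.D_cup_of_le (by simp at hj; omega)]
  have h2 : S.cup m (n + 1) f (S.delta n g) = ∑ j ∈ Finset.range (n + 1),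
      (-1 : ℤ) ^ (j + 1) • S.D (m + 1 + j) (S.cup m n f g) + S.cup m (n + 1) f (S.D 0 g) := by
    rw [delta, cup_sum, Finset.sum_range_succ']
    congr 1
    · refine Finset.sum_congr rfl fun j hj => ?_
      rw [← S.D_cup_of_gt (by omega) (by simp at hj; omega), add_right_comm, add_assoc]
    · simp
  rw [h1, h2, delta, show m + n + 2 = m + 1 + (n + 1) by omega, Finset.sum_range_add, add_assoc]
  congr 1
  rw [smul_add, add_comm (_ • _ : R), add_assoc, Finset.smul_sum]
  simp only [smul_smul, _root_.pow_succ, _root_.pow_add]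
  simp

/-- The insertion of an element of degree `n + 1` into an element of degree `i + 1 + s`, in
position `i`. -/
def insertion (n i s : ℕ) (f g : R) : R := S.pow (i + 1) n f * S.pow (n + i + 2) s (S.pow 0 i g)

/-- The cofaces of an insertion fall into three ranges: up to `i` they are cofaces of `f`, pushing
`g` to position `i + 1`; from `i + 1` to `i + n + 1` they are the inner cofaces of `g`; beyond that
they are cofaces of `f` of index at least `i + 2`. The coface `D (i + 1) f` does not occur. -/
theorem D_insertion_of_le {n i s j : ℕ} (h : j ≤ i) (f g : R) :
    S.D j (S.insertion n i s f g) = S.insertion n (i + 1) s (S.D j f) g := by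
  rw [insertion, insertion, map_mul, S.D_pow_of_le (by omega), S.D_pow_of_le (by omega),
    S.D_pow_mid (by omega) (by omega)]
  rfl

theorem D_insertion_mid {n i s j : ℕ} (h : 1 ≤ j) (h' : j ≤ n + 1) (f g : R) :
    S.D (i + j) (S.insertion n i s f g) = S.insertion (n + 1) i s f (S.D j g) := by
  rw [insertion, insertion, map_mul, S.D_pow_mid (by omega) (by omega), S.D_pow_of_le (by omega),
    add_comm i j, S.D_pow_of_ge (by omega), show n + i + 2 + 1 = n + 1 + i + 2 by omega]

theorem D_insertion_of_ge {n i s j : ℕ} (h : i + 2 ≤ j) (h' : j ≤ i + s + 2) (f g : R) :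
    S.D (j + n) (S.insertion n i s f g) = S.insertion n i (s + 1) (S.D j f) g := by
  rw [insertion, insertion, map_mul, S.D_pow_of_ge (by omega), S.D_pow_mid (by omega) (by omega)]

/-- The outer cofaces of `g` supply the missing `D (i + 1) f`: the first one with `g` in position `i
+ 1`, the last one (`insertion_D_last`) with `g` in position `i`. -/
theorem insertion_D_zero (n i s : ℕ) (f g : R) :
    S.insertion (n + 1) i s f (S.D 0 g) = S.insertion n (i + 1) s (S.D (i + 1) f) g := by
  rw [insertion, insertion, S.pow_succ_D, ← S.pow_succ, show n + 1 + i + 2 = n + (i + 1) + 2 by omega]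

theorem insertion_D_last (n i s : ℕ) (f g : R) :
    S.insertion (n + 1) i s f (S.D (n + 2) g) = S.insertion n i (s + 1) (S.D (i + 1) f) g := by
  rw [insertion, insertion, ← S.pow_succ, ← S.D_pow_of_ge (by omega),
    show n + 2 + i = n + i + 2 by omega, show n + 1 + i + 2 = n + i + 2 + 1 by omega, S.pow_succ_D]

/-- Insertion into an outer coface of `f` at its extreme position is a product of extensions. These
are the two ends of the telescoping sum. -/
theorem insertion_first (n s : ℕ) (f g : R) :
    S.insertion n 0 s (S.D 0 f) g = S.pow 0 (n + 1) f * S.pow (n + 2) s g := by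
  rw [insertion, S.pow_succ_D]
  rfl

theorem insertion_last (n m : ℕ) (f g : R) :
    S.insertion n m 0 (S.D (m + 1) f) g = S.cup m (n + 1) f g := by
  rw [insertion, cup, ← S.pow_succ]
  rfl

theorem sum_insertion {ι : Type*} (n i t : ℕ) (s : Finset ι) (c : ι → ℤ) (f : ι → R) (g : R) :
    S.insertion n i t (∑ l ∈ s, c l • f l) g = ∑ l ∈ s, c l • S.insertion n i t (f l) g := by
  simp only [insertion, pow_sum, pow_zsmul, Finset.sum_mul, smul_mul_assoc]

theorem insertion_sum {ι : Type*} (n i t : ℕ) (s : Finset ι) (c : ι → ℤ) (f : R) (g : ι → R) :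
    S.insertion n i t f (∑ l ∈ s, c l • g l) = ∑ l ∈ s, c l • S.insertion n i t f (g l) := by
  simp only [insertion, pow_sum, pow_zsmul, Finset.mul_sum, mul_smul_comm]

/-- The part of the alternating sum of the insertions of `g` into the cofaces of `f` in position
`i` that involves the cofaces up to the `i`-th. -/
def partialInsertion (m n : ℕ) (f g : R) (i : ℕ) : R :=
  ∑ j ∈ Finset.range (i + 1), (-1 : ℤ) ^ j • S.insertion n i (m - i) (S.D j f) g

theorem insertion_zero_left (n i s : ℕ) (g : R) : S.insertion n i s 0 g = 0 := by
  rw [insertion, pow_map_zero, zero_mul]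

theorem insertion_zero_right (n i s : ℕ) (f : R) : S.insertion n i s f 0 = 0 := by
  rw [insertion, pow_map_zero, pow_map_zero, mul_zero]

/-- The cocycle condition on `g` trades its inner cofaces for its two outer ones, which become
insertions into `D (i + 1) f`. The cocycle condition on `f` trades the cofaces of index above `i`
for those of index at most `i`. What remains is a difference of partial sums for neighbouring
positions. -/
theorem delta_insertion {n i s : ℕ} {f g : R} (hf : S.delta (i + 1 + s) f = 0)
    (hg : S.delta (n + 1) g = 0) :
    S.delta (i + 1 + s + n) (S.insertion n i s f g) =
      S.partialInsertion (i + 1 + s) n f g (i + 1) -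
        (-1 : ℤ) ^ n • S.partialInsertion (i + 1 + s) n f g i := by
  have hf' : S.insertion n i (s + 1) (S.delta (i + 1 + s) f) g = 0 := by
    rw [hf, insertion_zero_left]
  rw [delta, sum_insertion, show i + 1 + s + 2 = i + 1 + (s + 1 + 1) by omega,
    Finset.sum_range_add, Finset.sum_range_succ' _ (s + 1), add_eq_zero_iff_eq_neg] at hf'
  have hg' : S.insertion (n + 1) i s f (S.delta (n + 1) g) = 0 := by
    rw [hg, insertion_zero_right]
  rw [delta, insertion_sum, Finset.sum_range_succ, Finset.sum_range_succ',
    insertion_D_zero, insertion_D_last] at hg'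
  rw [partialInsertion, partialInsertion, show i + 1 + s - (i + 1) = s by omega,
    show i + 1 + s - i = s + 1 by omega, hf', delta,
    show i + 1 + s + n + 2 = i + 1 + (n + 1) + (s + 1) by omega, Finset.sum_range_add,
    Finset.sum_range_add, Finset.sum_range_succ _ (i + 1)]
  -- The three ranges of cofaces of the insertion are `e1`, `e2` and `e3`.
  have e1 : ∀ j ∈ Finset.range (i + 1), (-1 : ℤ) ^ j • S.D j (S.insertion n i s f g) =
      (-1 : ℤ) ^ j • S.insertion n (i + 1) s (S.D j f) g := fun j hj => by
    rw [S.D_insertion_of_le (by simp at hj; omega)]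
  have e2 : ∑ j ∈ Finset.range (n + 1), (-1 : ℤ) ^ (i + 1 + j) •
      S.D (i + 1 + j) (S.insertion n i s f g) = (-1 : ℤ) ^ i • ∑ j ∈ Finset.range (n + 1),
        (-1 : ℤ) ^ (j + 1) • S.insertion (n + 1) i s f (S.D (j + 1) g) := by
    rw [Finset.smul_sum]
    refine Finset.sum_congr rfl fun j hj => ?_
    rw [← S.D_insertion_mid (by omega) (by simp at hj; omega), smul_smul, ← _root_.pow_add,
      show i + 1 + j = i + (j + 1) by omega]
  have e3 : ∑ j ∈ Finset.range (s + 1), (-1 : ℤ) ^ (i + 1 + (n + 1) + j) •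
      S.D (i + 1 + (n + 1) + j) (S.insertion n i s f g) =
      (-1 : ℤ) ^ n • ∑ j ∈ Finset.range (s + 1), (-1 : ℤ) ^ (i + 1 + (j + 1)) •
        S.insertion n i (s + 1) (S.D (i + 1 + (j + 1)) f) g := by
    rw [Finset.smul_sum]
    refine Finset.sum_congr rfl fun j hj => ?_
    rw [← S.D_insertion_of_ge (by omega) (by simp at hj; omega), smul_smul, ← _root_.pow_add,
      show i + 1 + (n + 1) + j = i + 1 + (j + 1) + n by omega, add_comm n]
  rw [Finset.sum_congr rfl e1, e2, e3]
  have hg'' : ∑ j ∈ Finset.range (n + 1), (-1 : ℤ) ^ (j + 1) •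
      S.insertion (n + 1) i s f (S.D (j + 1) g) =
        -S.insertion n (i + 1) s (S.D (i + 1) f) g -
          (-1 : ℤ) ^ n • S.insertion n i (s + 1) (S.D (i + 1) f) g := by
    rw [_root_.pow_zero, one_smul, add_assoc, add_eq_zero_iff_eq_neg] at hg'
    rw [hg', neg_add, _root_.pow_add, sub_eq_add_neg]
    simp
  rw [hg'']
  rw [add_zero, _root_.pow_succ _ i]
  module

/-- The homotopy behind graded commutativity. The subtracted product is the opposite-order product
of `g` and `f`, that is, `g ⊔ f` for cochains. -/
theorem exists_delta_eq {m n : ℕ} {f g : R} (hf : S.delta m f = 0)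
    (hg : S.delta (n + 1) g = 0) :
    ∃ h : R, S.delta (m + n) h = (-1 : ℤ) ^ (m * (n + 1)) • S.cup m (n + 1) f g -
      S.pow 0 (n + 1) f * S.pow (n + 2) m g := by
  -- The signs are chosen so that the factor `(-1)^n` in `delta_insertion` is absorbed, since its
  -- square is `1`, and the sum telescopes.
  refine ⟨∑ i ∈ Finset.range m, ((-1 : ℤ) ^ n) ^ (i + 1) • S.insertion n i (m - 1 - i) f g, ?_⟩
  have key : ∀ i ∈ Finset.range m,
      S.delta (m + n) (((-1 : ℤ) ^ n) ^ (i + 1) • S.insertion n i (m - 1 - i) f g) =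
        ((-1 : ℤ) ^ n) ^ (i + 1) • S.partialInsertion m n f g (i + 1) -
          ((-1 : ℤ) ^ n) ^ i • S.partialInsertion m n f g i := fun i hi => by
    obtain ⟨s, rfl⟩ := Nat.exists_eq_add_of_le (show i + 1 ≤ m by simp at hi; omega)
    rw [show i + 1 + s - 1 - i = s by omega]
    have := S.delta_insertion hf hg
    simp only [delta, map_zsmul] at this ⊢
    simp only [smul_comm _ (((-1 : ℤ) ^ n) ^ (i + 1)), ← Finset.smul_sum]
    rw [this, smul_sub, smul_smul, _root_.pow_succ _ i, mul_assoc, ← _root_.pow_add,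
      Even.neg_one_pow ⟨n, rfl⟩, mul_one]
  have hd : S.delta (m + n) (∑ i ∈ Finset.range m,
      ((-1 : ℤ) ^ n) ^ (i + 1) • S.insertion n i (m - 1 - i) f g) =
      ∑ i ∈ Finset.range m, S.delta (m + n)
        (((-1 : ℤ) ^ n) ^ (i + 1) • S.insertion n i (m - 1 - i) f g) := by
    simp only [delta, map_sum, Finset.smul_sum]
    exact Finset.sum_comm
  rw [hd, Finset.sum_congr rfl key, Finset.sum_range_sub
    (fun i => ((-1 : ℤ) ^ n) ^ i • S.partialInsertion m n f g i)]
  have h0 : S.partialInsertion m n f g 0 = S.pow 0 (n + 1) f * S.pow (n + 2) m g := by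
    rw [partialInsertion, Finset.sum_range_one, insertion_first]
    simp
  -- At `i = m` the partial sum lacks only the last coface of `f`, so the cocycle condition reduces
  -- it to that single term.
  have hm : S.partialInsertion m n f g m = (-1 : ℤ) ^ m • S.cup m (n + 1) f g := by
    have hf' : S.insertion n m 0 (S.delta m f) g = 0 := by
      rw [hf, insertion_zero_left]
    rw [delta, sum_insertion, Finset.sum_range_succ, insertion_last,
      add_eq_zero_iff_eq_neg] at hf'
    rw [partialInsertion, Nat.sub_self, hf', _root_.pow_succ]
    simp
  rw [h0, hm, smul_smul, ← pow_mul, ← _root_.pow_add, _root_.pow_zero, one_smul,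
    show n * m + m = m * (n + 1) by ring]

/-- An element of degree `0` has no slot structure to insert; its cocycle condition `D 0 g = D 1 g`
does the work of the homotopy instead. -/
theorem pow_one_eq_of_delta {g : R} (hg : S.delta 0 g = 0) (m : ℕ) :
    S.pow 1 m g = S.pow 0 m g := by
  have h : S.D 1 g = S.D 0 g := by
    simp only [delta, Finset.sum_range_succ, Finset.sum_range_zero] at hg
    simp only [zero_add, _root_.pow_zero, one_smul, pow_one, neg_smul] at hg
    exact (add_neg_eq_zero.mp hg).symm
  cases m with
  | zero => rfl
  | succ m => rw [S.pow_succ, h, S.pow_succ_D]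

/-- The same operators on the opposite ring. -/
def op : CofaceSystem Rᵐᵒᵖ where
  D j := NonUnitalRingHom.op (S.D j)
  comm' h x := congrArg MulOpposite.op (S.comm' h x.unop)

end CofaceSystem

end Semicosimplicial

/-! ### Calculus of morphisms `V ⊗ P ⟶ P`: transport, extension and convolution. -/

section Operators

variable {D : Type u₂} [Category.{v₂} D] [MonoidalCategory D] {V P Q Q' A B : D}

/-- Transport of a morphism `V ⊗ Q ⟶ Q` along an isomorphism `P ≅ Q`. -/
def conjOp (e : P ≅ Q) (b : V ⊗ Q ⟶ Q) : V ⊗ P ⟶ P :=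
  V ◁ e.hom ≫ b ≫ e.inv

/-- Extension of a morphism `V ⊗ P ⟶ P` to `P ⊗ Q` by the identity of `Q`. -/
def whiskerRightOp (a : V ⊗ P ⟶ P) (Q : D) : V ⊗ (P ⊗ Q) ⟶ P ⊗ Q :=
  (α_ _ _ _).inv ≫ a ▷ Q

/-- Extension of a morphism `V ⊗ P ⟶ P` to `A ⊗ P`, moving `V` past `A` first. -/
def whiskerLeftOp (γ : V ⊗ A ⟶ A ⊗ V) (b : V ⊗ P ⟶ P) : V ⊗ (A ⊗ P) ⟶ A ⊗ P :=
  (α_ _ _ _).inv ≫ γ ▷ P ≫ (α_ _ _ _).hom ≫ A ◁ b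

/-- The convolution of two morphisms `V ⊗ P ⟶ P` with respect to `Δ : V ⟶ V ⊗ V`. -/
def convOp (Δ : V ⟶ V ⊗ V) (a b : V ⊗ P ⟶ P) : V ⊗ P ⟶ P :=
  Δ ▷ P ≫ (α_ _ _ _).hom ≫ V ◁ b ≫ a

theorem conjOp_conjOp (e : P ≅ Q) (e' : Q ≅ Q') (b : V ⊗ Q' ⟶ Q') :
    conjOp e (conjOp e' b) = conjOp (e ≪≫ e') b := by
  simp [conjOp]

/-- Naturality in place of equality of objects: components of a cochain at two different tuples give
the same operator on `P` once a morphism of tuples matches the identifications. -/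
theorem conjOp_eq_of_hom_comm (e : P ≅ Q) (e' : P ≅ Q') {b : V ⊗ Q ⟶ Q} {b' : V ⊗ Q' ⟶ Q'}
    (φ : Q ⟶ Q') (hb : V ◁ φ ≫ b' = b ≫ φ) (he : e.hom ≫ φ = e'.hom) :
    conjOp e b = conjOp e' b' := by
  have : φ ≫ e'.inv = e.inv := by rw [Iso.comp_inv_eq, ← he, Iso.inv_hom_id_assoc]
  rw [conjOp, conjOp, ← he, MonoidalCategory.whiskerLeft_comp_assoc, reassoc_of% hb, this]

theorem whiskerRightOp_conjOp (e : P ≅ Q) (b : V ⊗ Q ⟶ Q) (A : D) :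
    whiskerRightOp (conjOp e b) A = conjOp (whiskerRightIso e A) (whiskerRightOp b A) := by
  simp [conjOp, whiskerRightOp]

theorem conjOp_whiskerRightOp (e : A ≅ B) (b : V ⊗ P ⟶ P) :
    conjOp (whiskerLeftIso P e) (whiskerRightOp b B) = whiskerRightOp b A := by
  simp only [conjOp, whiskerRightOp, whiskerLeftIso_hom, whiskerLeftIso_inv, Category.assoc]
  calc
    _ = (α_ V P A).inv ≫ ((V ⊗ P) ◁ e.hom ≫ b ▷ B) ≫ P ◁ e.inv := by monoidal
    _ = _ := by rw [whisker_exchange]; simp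

theorem whiskerLeftOp_conjOp (γ : V ⊗ A ⟶ A ⊗ V) (e : P ≅ Q) (b : V ⊗ Q ⟶ Q) :
    whiskerLeftOp γ (conjOp e b) = conjOp (whiskerLeftIso A e) (whiskerLeftOp γ b) := by
  simp only [conjOp, whiskerLeftOp, whiskerLeftIso_hom, whiskerLeftIso_inv, Category.assoc]
  calc
    _ = (α_ _ _ _).inv ≫ (γ ▷ P ≫ (A ⊗ V) ◁ e.hom) ≫ (α_ _ _ _).hom ≫ A ◁ b ≫ A ◁ e.inv := by
      monoidal
    _ = _ := by rw [← whisker_exchange]; monoidal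

theorem conjOp_whiskerLeftOp (e : A ≅ B) {γ : V ⊗ A ⟶ A ⊗ V} {γ' : V ⊗ B ⟶ B ⊗ V}
    (h : V ◁ e.hom ≫ γ' = γ ≫ e.hom ▷ V) (b : V ⊗ P ⟶ P) :
    conjOp (whiskerRightIso e P) (whiskerLeftOp γ' b) = whiskerLeftOp γ b := by
  simp only [conjOp, whiskerLeftOp, whiskerRightIso_hom, whiskerRightIso_inv, Category.assoc]
  calc
    _ = (α_ _ _ _).inv ≫ (V ◁ e.hom ≫ γ') ▷ P ≫ (α_ _ _ _).hom ≫ B ◁ b ≫ e.inv ▷ P := by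
      monoidal
    _ = (α_ _ _ _).inv ≫ γ ▷ P ≫ (α_ _ _ _).hom ≫ (e.hom ▷ (V ⊗ P) ≫ B ◁ b) ≫ e.inv ▷ P := by
      rw [h]; monoidal
    _ = _ := by rw [← whisker_exchange]; simp

theorem whiskerRightOp_whiskerLeftOp (γ : V ⊗ A ⟶ A ⊗ V) (b : V ⊗ P ⟶ P) (Q : D) :
    whiskerRightOp (whiskerLeftOp γ b) Q =
      conjOp (α_ A P Q) (whiskerLeftOp γ (whiskerRightOp b Q)) := by
  simp only [conjOp, whiskerRightOp, whiskerLeftOp]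
  monoidal

theorem conjOp_whiskerRightOp_whiskerLeftOp (γ : V ⊗ A ⟶ A ⊗ V) (s : B ≅ P ⊗ Q)
    (b : V ⊗ P ⟶ P) :
    conjOp (whiskerLeftIso A s ≪≫ (α_ A P Q).symm) (whiskerRightOp (whiskerLeftOp γ b) Q) =
      whiskerLeftOp γ (conjOp s (whiskerRightOp b Q)) := by
  rw [whiskerRightOp_whiskerLeftOp, whiskerLeftOp_conjOp, conjOp_conjOp, Iso.trans_assoc,
    Iso.symm_self_id, Iso.trans_refl]

theorem whiskerRightOp_whiskerRightOp (b : V ⊗ P ⟶ P) (Q Q' : D) :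
    whiskerRightOp (whiskerRightOp b Q) Q' =
      conjOp (α_ P Q Q') (whiskerRightOp b (Q ⊗ Q')) := by
  simp only [conjOp, whiskerRightOp]
  monoidal

/-- The composite braiding on the right is both the one in the monoidality axiom of a half-braiding
and the recursion step of `iterBraid`. -/
theorem whiskerLeftOp_whiskerLeftOp (γ : V ⊗ A ⟶ A ⊗ V) (γ' : V ⊗ B ⟶ B ⊗ V)
    (b : V ⊗ P ⟶ P) :
    whiskerLeftOp γ (whiskerLeftOp γ' b) =
      conjOp (α_ A B P).symm (whiskerLeftOp ((α_ _ _ _).inv ≫ γ ▷ B ≫ (α_ _ _ _).hom ≫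
        A ◁ γ' ≫ (α_ _ _ _).inv) b) := by
  simp only [conjOp, whiskerLeftOp, Iso.symm_hom, Iso.symm_inv]
  monoidal

theorem convOp_conjOp (Δ : V ⟶ V ⊗ V) (e : P ≅ Q) (a b : V ⊗ Q ⟶ Q) :
    convOp Δ (conjOp e a) (conjOp e b) = conjOp e (convOp Δ a b) := by
  simp only [convOp, conjOp, Category.assoc, MonoidalCategory.whiskerLeft_comp]
  rw [← MonoidalCategory.whiskerLeft_comp_assoc V e.inv, Iso.inv_hom_id,
    MonoidalCategory.whiskerLeft_id, Category.id_comp, whisker_exchange_assoc]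
  monoidal

theorem convOp_whiskerRightOp (Δ : V ⟶ V ⊗ V) (a b : V ⊗ P ⟶ P) (Q : D) :
    convOp Δ (whiskerRightOp a Q) (whiskerRightOp b Q) = whiskerRightOp (convOp Δ a b) Q := by
  simp only [convOp, whiskerRightOp]
  monoidal

/-- The hypothesis says that `Δ` intertwines the half-braidings of `V` and `V ⊗ V`: two copies of
`V` moved past `A` separately can be moved as one before comultiplying. -/
theorem convOp_whiskerLeftOp {Δ : V ⟶ V ⊗ V} {γ : V ⊗ A ⟶ A ⊗ V}
    (h : Δ ▷ A ≫ (α_ _ _ _).hom ≫ V ◁ γ ≫ (α_ _ _ _).inv ≫ γ ▷ V ≫ (α_ _ _ _).hom = γ ≫ A ◁ Δ)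
    (a b : V ⊗ P ⟶ P) :
    convOp Δ (whiskerLeftOp γ a) (whiskerLeftOp γ b) = whiskerLeftOp γ (convOp Δ a b) := by
  simp only [convOp, whiskerLeftOp]
  calc
    _ = 𝟙 _ ⊗≫ Δ ▷ A ▷ P ⊗≫ V ◁ γ ▷ P ⊗≫ ((V ⊗ A) ◁ b ≫ γ ▷ P) ⊗≫ A ◁ a := by monoidal
    _ = 𝟙 _ ⊗≫ (Δ ▷ A ≫ (α_ _ _ _).hom ≫ V ◁ γ ≫ (α_ _ _ _).inv ≫ γ ▷ V ≫ (α_ _ _ _).hom) ▷ P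
        ⊗≫ A ◁ V ◁ b ⊗≫ A ◁ a := by rw [whisker_exchange]; monoidal
    _ = _ := by rw [h]; monoidal

theorem convOp_assoc {Δ : V ⟶ V ⊗ V} (h : Δ ≫ V ◁ Δ = Δ ≫ Δ ▷ V ≫ (α_ V V V).hom)
    (a b c : V ⊗ P ⟶ P) : convOp Δ (convOp Δ a b) c = convOp Δ a (convOp Δ b c) := by
  simp only [convOp]
  calc
    _ = 𝟙 _ ⊗≫ Δ ▷ P ⊗≫ (V ◁ c ≫ Δ ▷ P) ⊗≫ V ◁ b ≫ a := by monoidal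
    _ = 𝟙 _ ⊗≫ (Δ ≫ Δ ▷ V ≫ (α_ V V V).hom) ▷ P ⊗≫ V ◁ V ◁ c ⊗≫ V ◁ b ≫ a := by
      rw [whisker_exchange]; monoidal
    _ = _ := by rw [← h]; monoidal

theorem counit_convOp {Δ : V ⟶ V ⊗ V} {ε : V ⟶ 𝟙_ D} (h : Δ ≫ ε ▷ V = (λ_ V).inv)
    (b : V ⊗ P ⟶ P) : convOp Δ (ε ▷ P ≫ (λ_ P).hom) b = b := by
  simp only [convOp]
  calc
    _ = 𝟙 _ ⊗≫ Δ ▷ P ⊗≫ (V ◁ b ≫ ε ▷ P) ⊗≫ 𝟙 _ := by monoidal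
    _ = 𝟙 _ ⊗≫ (Δ ≫ ε ▷ V) ▷ P ⊗≫ (𝟙_ D) ◁ b ⊗≫ 𝟙 _ := by rw [whisker_exchange]; monoidal
    _ = _ := by rw [h]; monoidal

theorem convOp_counit {Δ : V ⟶ V ⊗ V} {ε : V ⟶ 𝟙_ D} (h : Δ ≫ V ◁ ε = (ρ_ V).inv)
    (b : V ⊗ P ⟶ P) : convOp Δ b (ε ▷ P ≫ (λ_ P).hom) = b := by
  simp only [convOp]
  calc
    _ = (Δ ≫ V ◁ ε) ▷ P ⊗≫ b := by monoidal
    _ = _ := by rw [h]; monoidal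

theorem conjOp_counit (ε : V ⟶ 𝟙_ D) (e : P ≅ Q) :
    conjOp e (ε ▷ Q ≫ (λ_ Q).hom) = ε ▷ P ≫ (λ_ P).hom := by
  simp only [conjOp]
  rw [Category.assoc, whisker_exchange_assoc]
  simp

theorem whiskerRightOp_counit (ε : V ⟶ 𝟙_ D) (Q : D) :
    whiskerRightOp (ε ▷ P ≫ (λ_ P).hom) Q = ε ▷ (P ⊗ Q) ≫ (λ_ (P ⊗ Q)).hom := by
  simp only [whiskerRightOp]
  monoidal

theorem whiskerLeftOp_counit {ε : V ⟶ 𝟙_ D} {γ : V ⊗ A ⟶ A ⊗ V}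
    (h : ε ▷ A ≫ (λ_ A).hom ≫ (ρ_ A).inv = γ ≫ A ◁ ε) (P : D) :
    whiskerLeftOp γ (ε ▷ P ≫ (λ_ P).hom) = ε ▷ (A ⊗ P) ≫ (λ_ (A ⊗ P)).hom := by
  simp only [whiskerLeftOp]
  calc
    _ = 𝟙 _ ⊗≫ (γ ≫ A ◁ ε) ▷ P ⊗≫ 𝟙 _ := by monoidal
    _ = _ := by rw [← h]; monoidal

end Operators

/-! ### Cosimplicial identities involving the first face. -/

section Cosimplicial

variable {C : Type u₁} [Category.{v₁} C] [MonoidalCategory C]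
variable {D : Type u₂} [Category.{v₂} D] [MonoidalCategory D]
variable {F : C ⥤ D} [F.Monoidal] {U : Centralizer F}

theorem Cochain.conjOp_ev {n : ℕ} (f : Cochain F U n) {P : D} {X Y : Fin n → C} (φ : X ⟶ Y)
    (e : P ≅ (tensorPow F n).obj X) (e' : P ≅ (tensorPow F n).obj Y)
    (he : e.hom ≫ (tensorPow F n).map φ = e'.hom) :
    conjOp e (f.ev X) = conjOp e' (f.ev Y) :=
  conjOp_eq_of_hom_comm e e' _ (f.ev_naturality φ) he

theorem innerFace_ev_eq {n : ℕ} (i : Fin n) (f : Cochain F U n) (X : Fin (n + 1) → C) :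
    (innerFace i f).ev X = conjOp (mergeIso F i X) (f.ev ((merge i).obj X)) := rfl

theorem lastFace_ev_eq {n : ℕ} (f : Cochain F U n) (X : Fin (n + 1) → C) :
    (lastFace f).ev X = conjOp (split F (m := n) (n := 1) rfl X)
      (whiskerRightOp (f.ev ((front rfl).obj X)) _) := by
  rw [lastFace_ev, conjOp, whiskerRightOp, Category.assoc]

/-- Monoidality of the half-braiding: moving `U` past `F (X₀ ⊗ X₁)` amounts to moving it past `F X₀`
and then `F X₁`. -/
theorem innerFace_zero_firstFace {n : ℕ} (f : Cochain F U n) :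
    innerFace 0 (firstFace f) = firstFace (firstFace f) :=
  Cochain.ext_ev fun X => by
    refine Eq.trans ?_ (whiskerLeftOp_whiskerLeftOp (U.braid.β (X 0)).hom (U.braid.β (X 1)).hom
      (f.ev fun i => X i.succ.succ)).symm
    refine Eq.trans (conjOp_conjOp (α_ (F.obj (X 0)) (F.obj (X 1)) _).symm
      (whiskerRightIso (Functor.Monoidal.μIso F (X 0) (X 1)) _)
      (whiskerLeftOp (U.braid.β (X 0 ⊗ X 1)).hom (f.ev fun i => X i.succ.succ))).symm
      (congrArg _ (conjOp_whiskerLeftOp _ ?_ _))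
    simpa using U.braid.monoidal (X 0) (X 1)

theorem innerFace_succ_firstFace {n : ℕ} (i : Fin n) (f : Cochain F U n) :
    innerFace i.succ (firstFace f) = firstFace (innerFace i f) :=
  Cochain.ext_ev fun X =>
    (whiskerLeftOp_conjOp (U.braid.β (X 0)).hom (mergeIso F i (fun j => X j.succ)) _).symm

theorem lastFace_firstFace {n : ℕ} (f : Cochain F U n) :
    lastFace (firstFace f) = firstFace (lastFace f) :=
  Cochain.ext_ev fun X =>
    (lastFace_ev_eq _ _).trans ((conjOp_whiskerRightOp_whiskerLeftOp (U.braid.β (X 0)).hom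
      (split F (m := n) (n := 1) rfl fun i => X i.succ)
      (f.ev ((front rfl).obj fun i => X i.succ))).trans
      (congrArg (whiskerLeftOp (U.braid.β (X 0)).hom) (lastFace_ev_eq f fun i => X i.succ)).symm)

end Cosimplicial

/-! ### Comparison of extensions along different splittings. -/

section Operators

variable {D : Type u₂} [Category.{v₂} D] [MonoidalCategory D] {V P Q Q' A B : D}

theorem conjOp_whiskerRightOp_congr {P' : D} (s : A ≅ P ⊗ Q) (s' : A ≅ P' ⊗ Q')
    {b : V ⊗ P ⟶ P} {b' : V ⊗ P' ⟶ P'} (φ : P ⟶ P') (e : Q ≅ Q')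
    (hb : V ◁ φ ≫ b' = b ≫ φ) (hs : s.hom ≫ (φ ⊗ₘ e.hom) = s'.hom) :
    conjOp s (whiskerRightOp b Q) = conjOp s' (whiskerRightOp b' Q') := by
  rw [← conjOp_whiskerRightOp e b, conjOp_conjOp]
  refine conjOp_eq_of_hom_comm _ _ (φ ▷ Q') ?_ ?_
  · simp only [whiskerRightOp]
    calc
      _ = (α_ _ _ _).inv ≫ (V ◁ φ ≫ b') ▷ Q' := by monoidal
      _ = _ := by rw [hb]; monoidal
  · rw [← hs, tensorHom_def']
    simp

theorem conjOp_whiskerRightOp_congr_right (s : A ≅ P ⊗ Q) (s' : A ≅ P ⊗ Q')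
    (b : V ⊗ P ⟶ P) (e : Q ≅ Q') (hs : s.hom ≫ P ◁ e.hom = s'.hom) :
    conjOp s (whiskerRightOp b Q) = conjOp s' (whiskerRightOp b Q') :=
  conjOp_whiskerRightOp_congr s s' (𝟙 P) e (by simp) (by rw [id_tensorHom, hs])

theorem conjOp_rightUnitor_whiskerRightOp (b : V ⊗ P ⟶ P) :
    conjOp (ρ_ P).symm (whiskerRightOp b (𝟙_ D)) = b := by
  simp [conjOp, whiskerRightOp]

theorem conjOp_leftUnitor_whiskerLeftOp (b : V ⊗ P ⟶ P) :
    conjOp (λ_ P).symm (whiskerLeftOp ((ρ_ V).hom ≫ (λ_ V).inv) b) = b := by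
  simp [conjOp, whiskerLeftOp]

end Operators

/-! ### Cosimplicial identities for inner and last faces; iterated outer faces. -/

section Cosimplicial

variable {C : Type u₁} [Category.{v₁} C] [MonoidalCategory C]
variable {D : Type u₂} [Category.{v₂} D] [MonoidalCategory D]
variable {F : C ⥤ D} [F.Monoidal] {U : Centralizer F}

theorem μ_assoc_tensor (X Y Z : C) (P : D) :
    ((α_ (F.obj X) (F.obj Y) (F.obj Z ⊗ P)).inv ≫
      Functor.LaxMonoidal.μ F X Y ▷ (F.obj Z ⊗ P)) ≫
        ((α_ (F.obj (X ⊗ Y)) (F.obj Z) P).inv ≫ Functor.LaxMonoidal.μ F (X ⊗ Y) Z ▷ P) ≫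
          (F.map (α_ X Y Z).hom ⊗ₘ 𝟙 P) =
      (F.obj X ◁ ((α_ (F.obj Y) (F.obj Z) P).inv ≫ Functor.LaxMonoidal.μ F Y Z ▷ P)) ≫
        (α_ (F.obj X) (F.obj (Y ⊗ Z)) P).inv ≫ Functor.LaxMonoidal.μ F X (Y ⊗ Z) ▷ P := by
  rw [tensorHom_id]
  calc
    _ = 𝟙 _ ⊗≫ (Functor.LaxMonoidal.μ F X Y ▷ F.obj Z ≫ Functor.LaxMonoidal.μ F (X ⊗ Y) Z ≫
        F.map (α_ X Y Z).hom) ▷ P := by monoidal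
    _ = _ := by rw [Functor.LaxMonoidal.associativity]; monoidal

/-- When `a = c` the two merged tuples contain `(X ⊗ Y) ⊗ Z` and `X ⊗ (Y ⊗ Z)`, which are only
isomorphic. The morphism of tuples is then the associator in that entry, and the identity follows
from associativity of `μ`; when `a < c` the merges are disjoint. -/
theorem exists_merge_merge : ∀ {n : ℕ} (a c : Fin n) (_ : a ≤ c) (X : Fin (n + 2) → C),
    ∃ φ : (merge c).obj ((merge a.castSucc).obj X) ⟶ (merge a).obj ((merge c.succ).obj X),
      ((mergeIso F a.castSucc X).hom ≫ (mergeIso F c _).hom) ≫ (tensorPow F n).map φ =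
        (mergeIso F c.succ X).hom ≫ (mergeIso F a _).hom
  | n + 1, ⟨0, _⟩, ⟨0, _⟩, _, X => by
    refine ⟨consHom (α_ (X 0) (X 1) (X 2)).hom (fun j => 𝟙 (X j.succ.succ.succ)), ?_⟩
    rw [Category.assoc]
    refine Eq.trans ?_ (μ_assoc_tensor (X 0) (X 1) (X 2)
      ((tensorPow F n).obj fun j => X j.succ.succ.succ))
    refine congrArg (_ ≫ _ ≫ ·) (congrArg (F.map (α_ (X 0) (X 1) (X 2)).hom ⊗ₘ ·) ?_)
    exact (tensorPow F n).map_id _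
  | n + 1, ⟨0, _⟩, ⟨c + 1, hc⟩, _, X => by
    refine ⟨𝟙 _, ?_⟩
    refine (congrArg (_ ≫ ·) ((tensorPow F (n + 1)).map_id _)).trans
      ((Category.comp_id _).trans ?_)
    have key : ∀ (A B E : D) {P Q : D} (m : A ⊗ B ⟶ E) (g : P ⟶ Q),
        ((α_ A B P).inv ≫ m ▷ P) ≫ E ◁ g = (A ◁ B ◁ g) ≫ (α_ A B Q).inv ≫ m ▷ Q := by
      intros
      rw [Category.assoc, ← whisker_exchange]
      simp
    exact key (F.obj (X 0)) (F.obj (X 1)) _ (Functor.LaxMonoidal.μ F (X 0) (X 1))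
      (mergeIso F (⟨c, by omega⟩ : Fin n) fun j => X j.succ.succ).hom
  | n + 1, ⟨a + 1, ha⟩, ⟨c + 1, hc⟩, h, X => by
    obtain ⟨φ, hφ⟩ := exists_merge_merge (n := n) ⟨a, by omega⟩ ⟨c, by omega⟩
      (Nat.le_of_succ_le_succ h) (fun j => X j.succ)
    refine ⟨consHom (𝟙 (X 0)) φ, ?_⟩
    have key : ∀ (A : D) {P Q R S T : D} (p : P ⟶ Q) (q : Q ⟶ R) (r : R ⟶ S) (s : P ⟶ T)
        (t : T ⟶ S), (p ≫ q) ≫ r = s ≫ t → ∀ i : A ⟶ A, i = 𝟙 A →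
        (A ◁ p ≫ A ◁ q) ≫ (i ⊗ₘ r) = A ◁ s ≫ A ◁ t := by
      intro A P Q R S T p q r s t h i hi
      rw [hi, id_tensorHom, ← MonoidalCategory.whiskerLeft_comp,
        ← MonoidalCategory.whiskerLeft_comp, ← MonoidalCategory.whiskerLeft_comp, h]
    exact key (F.obj (X 0)) _ _ _ _ _ hφ _ (F.map_id _)

theorem innerFace_succ_innerFace {n : ℕ} {a c : Fin n} (h : a ≤ c) (f : Cochain F U n) :
    innerFace c.succ (innerFace a f) = innerFace a.castSucc (innerFace c f) :=
  Cochain.ext_ev fun X => by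
    obtain ⟨φ, hφ⟩ := exists_merge_merge (F := F) a c h X
    rw [innerFace_ev_eq, innerFace_ev_eq, innerFace_ev_eq, innerFace_ev_eq, conjOp_conjOp,
      conjOp_conjOp]
    exact (f.conjOp_ev φ _ _ hφ).symm

/-- Extension of a cochain of degree `m` to degree `N = m + n` by the identity of the last `n`
tensor factors. -/
def frontExtend {m n N : ℕ} (h : m + n = N) (f : Cochain F U m) : Cochain F U N :=
  Cochain.ofFamily
    (fun X => conjOp (split F h X)
      (whiskerRightOp (f.ev ((front h).obj X)) ((tensorPow F n).obj ((back h).obj X))))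
    (fun {X Y} φ => by
      have hf := f.ev_naturality ((front h).map φ)
      simp only [conjOp, whiskerRightOp, Category.assoc]
      rw [split_inv_naturality, ← MonoidalCategory.whiskerLeft_comp_assoc, split_naturality,
        MonoidalCategory.whiskerLeft_comp_assoc]
      congr 1
      rw [← id_tensorHom, associator_inv_naturality_assoc, ← tensorHom_id, ← tensorHom_id,
        tensorHom_comp_tensorHom_assoc, tensorHom_comp_tensorHom_assoc, id_tensorHom, hf]
      simp only [Category.comp_id, Category.id_comp])

theorem frontExtend_ev {m n N : ℕ} (h : m + n = N) (f : Cochain F U m) (X : Fin N → C) :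
    (frontExtend h f).ev X = conjOp (split F h X)
      (whiskerRightOp (f.ev ((front h).obj X)) ((tensorPow F n).obj ((back h).obj X))) := rfl

/-- The tuples obtained in the two orders agree entry by entry. A morphism with identity entries is
used to compare them, so that no object has to be transported along an equality. -/
theorem exists_split_merge : ∀ {n : ℕ} (i : Fin n) (X : Fin (n + 2) → C),
    ∃ (φ : (merge i).obj ((front (m := n + 1) (n := 1) rfl).obj X) ⟶
        (front (m := n) (n := 1) rfl).obj ((merge i.castSucc).obj X))
      (e : (tensorPow F 1).obj ((back (m := n + 1) (n := 1) rfl).obj X) ≅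
        (tensorPow F 1).obj ((back (m := n) (n := 1) rfl).obj ((merge i.castSucc).obj X))),
      ((split F (m := n + 1) (n := 1) rfl X).hom ≫ (mergeIso F i _).hom ▷ _) ≫
          ((tensorPow F n).map φ ⊗ₘ e.hom) =
        (mergeIso F i.castSucc X).hom ≫ (split F (m := n) (n := 1) rfl _).hom
  | n + 1, ⟨0, _⟩, X => by
    refine ⟨consHom (𝟙 (X 0 ⊗ X 1)) (fun j => 𝟙 (X ⟨j + 2, by omega⟩)), Iso.refl _, ?_⟩
    have key : ∀ (A B E : D) {P Q R : D} (m : A ⊗ B ⟶ E) (g : P ⟶ Q ⊗ R) (i : E ⟶ E)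
        (j : Q ⟶ Q), i = 𝟙 E → j = 𝟙 Q →
        ((A ◁ (B ◁ g ≫ (α_ B Q R).inv) ≫ (α_ A (B ⊗ Q) R).inv) ≫
          ((α_ A B Q).inv ≫ m ▷ Q) ▷ R) ≫ ((i ⊗ₘ j) ⊗ₘ 𝟙 R) =
        ((α_ A B P).inv ≫ m ▷ P) ≫ (E ◁ g ≫ (α_ E Q R).inv) := by
      rintro A B E P Q R m g _ _ rfl rfl
      rw [id_tensorHom_id, id_tensorHom_id, Category.comp_id]
      calc
        _ = 𝟙 _ ⊗≫ ((A ⊗ B) ◁ g ≫ m ▷ (Q ⊗ R)) ⊗≫ 𝟙 _ := by monoidal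
        _ = _ := by rw [whisker_exchange]; monoidal
    exact key (F.obj (X 0)) (F.obj (X 1)) _ (Functor.LaxMonoidal.μ F (X 0) (X 1))
      (split F (m := n) (n := 1) rfl fun j => X j.succ.succ).hom _ _ (F.map_id _)
      ((tensorPow F n).map_id _)
  | n + 1, ⟨i + 1, hi⟩, X => by
    obtain ⟨φ, e, hφ⟩ := exists_split_merge (n := n) ⟨i, by omega⟩ (fun j => X j.succ)
    refine ⟨consHom (𝟙 (X 0)) φ, e, ?_⟩
    have key : ∀ (A : D) {P Q R S Q' R' T : D} (s : P ⟶ Q ⊗ R) (m : Q ⟶ Q') (p : Q' ⟶ S)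
        (e : R ⟶ R') (m' : P ⟶ T) (s' : T ⟶ S ⊗ R'),
        (s ≫ m ▷ R) ≫ (p ⊗ₘ e) = m' ≫ s' → ∀ i : A ⟶ A, i = 𝟙 A →
        ((A ◁ s ≫ (α_ A Q R).inv) ≫ (A ◁ m) ▷ R) ≫ ((i ⊗ₘ p) ⊗ₘ e) =
          A ◁ m' ≫ (A ◁ s' ≫ (α_ A S R').inv) := by
      rintro A P Q R S Q' R' T s m p e m' s' h _ rfl
      rw [← MonoidalCategory.whiskerLeft_comp_assoc, ← h]
      simp only [MonoidalCategory.tensorHom_def]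
      monoidal
    exact key (F.obj (X 0)) _ _ _ _ _ _ hφ _ (F.map_id _)

theorem lastFace_innerFace {n : ℕ} (i : Fin n) (f : Cochain F U n) :
    lastFace (innerFace i f) = innerFace i.castSucc (lastFace f) :=
  Cochain.ext_ev fun X => by
    obtain ⟨φ, e, h⟩ := exists_split_merge (F := F) i X
    rw [lastFace_ev_eq, innerFace_ev_eq, innerFace_ev_eq, lastFace_ev_eq, whiskerRightOp_conjOp,
      conjOp_conjOp, conjOp_conjOp]
    exact conjOp_whiskerRightOp_congr _ _ _ e (f.ev_naturality φ) h

/-- The last two factors are acted on by the identity, so it does not matter whether they are kept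
apart or merged; `e` is the identification of the two forms. -/
theorem exists_split_merge_last : ∀ {n : ℕ} (X : Fin (n + 2) → C),
    ∃ (φ : (front (m := n) (n := 1) rfl).obj ((front (m := n + 1) (n := 1) rfl).obj X) ⟶
        (front (m := n) (n := 1) rfl).obj ((merge (Fin.last n)).obj X))
      (e : (tensorPow F 1).obj ((back (m := n) (n := 1) rfl).obj
            ((front (m := n + 1) (n := 1) rfl).obj X)) ⊗
          (tensorPow F 1).obj ((back (m := n + 1) (n := 1) rfl).obj X) ≅
        (tensorPow F 1).obj ((back (m := n) (n := 1) rfl).obj ((merge (Fin.last n)).obj X))),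
      ((split F (m := n + 1) (n := 1) rfl X).hom ≫
          (split F (m := n) (n := 1) rfl _).hom ▷ _ ≫ (α_ _ _ _).hom) ≫
          ((tensorPow F n).map φ ⊗ₘ e.hom) =
        (mergeIso F (Fin.last n) X).hom ≫ (split F (m := n) (n := 1) rfl _).hom
  | 0, X => by
    refine ⟨fun j => j.elim0,
      (split F (m := 1) (n := 1) rfl X).symm ≪≫ mergeIso F (Fin.last 0) X, ?_⟩
    have key : ∀ {P Q R S : D} (s : P ≅ Q ⊗ R) (m : P ⟶ S) (i : 𝟙_ D ⟶ 𝟙_ D), i = 𝟙 _ →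
        (s.hom ≫ (λ_ Q).inv ▷ R ≫ (α_ (𝟙_ D) Q R).hom) ≫ (i ⊗ₘ (s.inv ≫ m)) =
          m ≫ (λ_ S).inv := by
      rintro P Q R S s m _ rfl
      rw [id_tensorHom]
      simp
    exact key (split F (m := 1) (n := 1) rfl X) _ _ rfl
  | n + 1, X => by
    obtain ⟨φ, e, hφ⟩ := exists_split_merge_last (n := n) (fun j => X j.succ)
    refine ⟨consHom (𝟙 (X 0)) φ, e, ?_⟩
    have key : ∀ (A : D) {P Q R S Q' R' S' T W : D} (s : P ⟶ Q ⊗ R) (t : Q ⟶ Q' ⊗ R')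
        (p : Q' ⟶ S) (e : R' ⊗ R ⟶ S') (m' : P ⟶ T) (s' : T ⟶ S ⊗ S'),
        (s ≫ t ▷ R ≫ (α_ Q' R' R).hom) ≫ (p ⊗ₘ e) = m' ≫ s' → ∀ i : A ⟶ A, i = 𝟙 A →
        ((A ◁ s ≫ (α_ A Q R).inv) ≫ (A ◁ t ≫ (α_ A Q' R').inv) ▷ R ≫ (α_ (A ⊗ Q') R' R).hom) ≫
          ((i ⊗ₘ p) ⊗ₘ e) = A ◁ m' ≫ (A ◁ s' ≫ (α_ A S S').inv) := by
      rintro A P Q R S Q' R' S' T W s t p e m' s' h _ rfl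
      rw [← MonoidalCategory.whiskerLeft_comp_assoc, ← h]
      simp only [MonoidalCategory.tensorHom_def]
      monoidal
    exact key (W := F.obj (X 0)) (F.obj (X 0)) _ _ _ _ _ _ hφ _ (F.map_id _)

theorem lastFace_lastFace {n : ℕ} (f : Cochain F U n) :
    lastFace (lastFace f) = innerFace (Fin.last n) (lastFace f) :=
  Cochain.ext_ev fun X => by
    obtain ⟨φ, e, h⟩ := exists_split_merge_last (F := F) X
    rw [lastFace_ev_eq, lastFace_ev_eq, innerFace_ev_eq, lastFace_ev_eq, whiskerRightOp_conjOp,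
      whiskerRightOp_whiskerRightOp, conjOp_conjOp, conjOp_conjOp, conjOp_conjOp]
    exact conjOp_whiskerRightOp_congr _ _ _ e (f.ev_naturality φ) (by simpa using h)

set_option linter.unusedSectionVars false in
theorem exists_split_split (F : C ⥤ D) : ∀ {m n N : ℕ} (h : m + n = N)
    (h' : m + (n + 1) = N + 1) (X : Fin (N + 1) → C),
    ∃ e : (tensorPow F n).obj ((back h).obj ((front (m := N) (n := 1) rfl).obj X)) ⊗
          (tensorPow F 1).obj ((back (m := N) (n := 1) rfl).obj X) ≅
        (tensorPow F (n + 1)).obj ((back h').obj X),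
      ((split F (m := N) (n := 1) rfl X).hom ≫ (split F h _).hom ▷ _ ≫ (α_ _ _ _).hom) ≫
          _ ◁ e.hom = (split F h' X).hom
  | 0, n, N, h, h', X => by
    obtain rfl : n = N := (Nat.zero_add n).symm.trans h
    refine ⟨(split F (m := n) (n := 1) rfl X).symm, ?_⟩
    have key : ∀ {P Q R : D} (s : P ≅ Q ⊗ R),
        (s.hom ≫ (λ_ Q).inv ▷ R ≫ (α_ (𝟙_ D) Q R).hom) ≫ (𝟙_ D) ◁ s.inv = (λ_ P).inv := by
      intro P Q R s
      simp
    exact key (split F (m := n) (n := 1) rfl X)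
  | m + 1, n, 0, h, _, _ => absurd h (by omega)
  | m + 1, n, N + 1, h, h', X => by
    obtain ⟨e, he⟩ := exists_split_split F (m := m) (n := n) (N := N) (by omega) (by omega)
      (fun j => X j.succ)
    refine ⟨e, ?_⟩
    have key : ∀ (A : D) {P Q R Q' R' S' : D} (s : P ⟶ Q ⊗ R) (t : Q ⟶ Q' ⊗ R')
        (e : R' ⊗ R ⟶ S') (s' : P ⟶ Q' ⊗ S'),
        (s ≫ t ▷ R ≫ (α_ Q' R' R).hom) ≫ Q' ◁ e = s' →
        ((A ◁ s ≫ (α_ A Q R).inv) ≫ (A ◁ t ≫ (α_ A Q' R').inv) ▷ R ≫ (α_ (A ⊗ Q') R' R).hom) ≫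
          (A ⊗ Q') ◁ e = A ◁ s' ≫ (α_ A Q' S').inv := by
      rintro A P Q R Q' R' S' s t e s' rfl
      monoidal
    exact key (F.obj (X 0)) _ _ _ _ he

/-- By induction on `n`, `frontExtend` is an iterated last face; this links the closed formula in
the products to the coface operators. -/
theorem lastFace_frontExtend {m n N : ℕ} (h : m + n = N) (h' : m + (n + 1) = N + 1)
    (f : Cochain F U m) : lastFace (frontExtend h f) = frontExtend h' f :=
  Cochain.ext_ev fun X => by
    obtain ⟨e, he⟩ := exists_split_split F h h' X
    rw [lastFace_ev_eq, frontExtend_ev, frontExtend_ev, whiskerRightOp_conjOp,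
      whiskerRightOp_whiskerRightOp, conjOp_conjOp, conjOp_conjOp]
    exact conjOp_whiskerRightOp_congr_right _ _ _ e (by simpa using he)

-- Since `tensorPow` ends in a unit object, splitting off no factors on the right is the inverse
-- right unitor.
set_option linter.unusedSectionVars false in
theorem split_zero_right (F : C ⥤ D) : ∀ {n : ℕ} (h : n + 0 = n) (X : Fin n → C),
    split F h X = (ρ_ ((tensorPow F n).obj X)).symm
  | 0, _, _ => Iso.ext unitors_inv_equal
  | n + 1, _, X => by
    refine (congrArg (fun s => whiskerLeftIso (F.obj (X 0)) s ≪≫ (α_ _ _ _).symm)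
      (split_zero_right F (n := n) rfl fun i => X i.succ)).trans (Iso.ext ?_)
    exact (rightUnitor_tensor_inv _ _).symm

theorem frontExtend_zero {n : ℕ} (h : n + 0 = n) (f : Cochain F U n) : frontExtend h f = f :=
  Cochain.ext_ev fun X =>
    (congrArg (fun s => conjOp s (whiskerRightOp (f.ev X) (𝟙_ D))) (split_zero_right F h X)).trans
      (conjOp_rightUnitor_whiskerRightOp _)

/-- Extension of a cochain of degree `n` to degree `N = m + n` by moving `U` past the first `m`
tensor factors. -/
def backExtend : {m n N : ℕ} → (h : m + n = N) → (g : Cochain F U n) → Cochain F U N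
  | 0, n, N, h, g =>
    match N, (Nat.zero_add n).symm.trans h with
    | _, rfl => g
  | m + 1, n, 0, h, _ => absurd h (by omega)
  | m + 1, n, N + 1, h, g => firstFace (backExtend (m := m) (n := n) (N := N) (by omega) g)

theorem backExtend_zero {n : ℕ} (h : 0 + n = n) (g : Cochain F U n) : backExtend h g = g := rfl

theorem firstFace_backExtend {m n N : ℕ} (h : m + n = N) (h' : m + 1 + n = N + 1)
    (g : Cochain F U n) : firstFace (backExtend h g) = backExtend h' g := rfl

/-- Iterating the first face moves `U` past one factor at a time, which is how `iterBraid` is built.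
-/
theorem backExtend_ev : ∀ {m n N : ℕ} (h : m + n = N) (g : Cochain F U n) (X : Fin N → C),
    (backExtend h g).ev X = conjOp (split F h X)
      (whiskerLeftOp (iterBraid U m ((front h).obj X)) (g.ev ((back h).obj X)))
  | 0, n, N, h, g, X => by
    obtain rfl : n = N := (Nat.zero_add n).symm.trans h
    exact (conjOp_leftUnitor_whiskerLeftOp _).symm
  | m + 1, n, 0, h, _, _ => absurd h (by omega)
  | m + 1, n, N + 1, h, g, X => by
    have ih := backExtend_ev (m := m) (n := n) (N := N) (by omega) g fun j => X j.succ
    refine (congrArg (whiskerLeftOp (U.braid.β (X 0)).hom) ih).trans ?_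
    rw [whiskerLeftOp_conjOp, whiskerLeftOp_whiskerLeftOp, conjOp_conjOp]
    rfl

end Cosimplicial

/-! ### Coface systems on the opposite ring. -/

namespace CofaceSystem

variable {R : Type*} [NonUnitalRing R] (S : CofaceSystem R)

theorem op_pow (a r : ℕ) (x : R) :
    S.op.pow a r (MulOpposite.op x) = MulOpposite.op (S.pow a r x) := by
  induction r with
  | zero => rfl
  | succ r ih => rw [pow_succ', ih, pow_succ']; rfl

theorem op_cup (m n : ℕ) (f g : R) :
    S.op.cup m n (MulOpposite.op f) (MulOpposite.op g) =
      MulOpposite.op (S.pow 0 m g * S.pow (m + 1) n f) := by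
  rw [cup, op_pow, op_pow, ← MulOpposite.op_mul]

theorem op_delta (n : ℕ) (x : R) :
    S.op.delta n (MulOpposite.op x) = MulOpposite.op (S.delta n x) := by
  rw [delta, delta, Finset.op_sum]
  rfl

end CofaceSystem

/-! ### Convolution of cochains; both products as convolutions of extensions. -/

section Convolution

variable {C : Type u₁} [Category.{v₁} C] [MonoidalCategory C]
variable {D : Type u₂} [Category.{v₂} D] [MonoidalCategory D]
variable {F : C ⥤ D} [F.Monoidal] {U : Centralizer F} [ComonObj U]

variable (U) in
theorem comulHom_coassoc : comulHom U ≫ U.pt ◁ comulHom U =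
    comulHom U ≫ comulHom U ▷ U.pt ≫ (α_ U.pt U.pt U.pt).hom :=
  congrArg Centralizer.Hom.f (ComonObj.comul_assoc U)

variable (U) in
theorem counitHom_comulHom : comulHom U ≫ counitHom U ▷ U.pt = (λ_ U.pt).inv :=
  congrArg Centralizer.Hom.f (ComonObj.counit_comul U)

variable (U) in
theorem comulHom_counitHom : comulHom U ≫ U.pt ◁ counitHom U = (ρ_ U.pt).inv :=
  congrArg Centralizer.Hom.f (ComonObj.comul_counit U)

variable (U) in
theorem comulHom_braid (X : C) : comulHom U ▷ F.obj X ≫ (α_ _ _ _).hom ≫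
    U.pt ◁ (U.braid.β X).hom ≫ (α_ _ _ _).inv ≫ (U.braid.β X).hom ▷ U.pt ≫ (α_ _ _ _).hom =
      (U.braid.β X).hom ≫ F.obj X ◁ comulHom U :=
  (ComonObj.comul (X := U)).comm X

variable (U) in
theorem counitHom_braid (X : C) : counitHom U ▷ F.obj X ≫ (λ_ _).hom ≫ (ρ_ _).inv =
    (U.braid.β X).hom ≫ F.obj X ◁ counitHom U :=
  (ComonObj.counit (X := U)).comm X

/-- The convolution product of two cochains of the same degree. -/
def Cochain.conv {n : ℕ} (f g : Cochain F U n) : Cochain F U n :=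
  Cochain.ofFamily (fun X => convOp (comulHom U) (f.ev X) (g.ev X)) (fun {X Y} φ => by
    rw [convOp, convOp]
    simp only [Category.assoc]
    rw [← f.ev_naturality φ, ← MonoidalCategory.whiskerLeft_comp_assoc U.pt (g.ev X),
      ← g.ev_naturality φ, whisker_exchange_assoc]
    simp)

theorem Cochain.conv_ev {n : ℕ} (f g : Cochain F U n) (X : Fin n → C) :
    (f.conv g).ev X = convOp (comulHom U) (f.ev X) (g.ev X) := rfl

/-- The unit cochain of degree `n` for the convolution product. -/
def Cochain.convOne (U : Centralizer F) [ComonObj U] (n : ℕ) : Cochain F U n :=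
  Cochain.ofFamily (fun X => counitHom U ▷ (tensorPow F n).obj X ≫ (λ_ _).hom) (fun {X Y} φ => by
    rw [whisker_exchange_assoc]
    simp)

theorem Cochain.convOne_ev (n : ℕ) (X : Fin n → C) : (Cochain.convOne U n).ev X =
    counitHom U ▷ (tensorPow F n).obj X ≫ (λ_ _).hom := rfl

theorem unitCochain_eq : unitCochain U = Cochain.convOne U 0 :=
  Cochain.ext_ev fun X => by
    change (ρ_ U.pt).hom ≫ counitHom U = counitHom U ▷ 𝟙_ D ≫ (λ_ (𝟙_ D)).hom
    rw [unitors_equal, rightUnitor_naturality]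

theorem Cochain.conv_assoc {n : ℕ} (f g h : Cochain F U n) :
    (f.conv g).conv h = f.conv (g.conv h) :=
  Cochain.ext_ev fun _ => convOp_assoc (comulHom_coassoc U) _ _ _

theorem Cochain.convOne_conv {n : ℕ} (f : Cochain F U n) : (Cochain.convOne U n).conv f = f :=
  Cochain.ext_ev fun _ => counit_convOp (counitHom_comulHom U) _

theorem Cochain.conv_convOne {n : ℕ} (f : Cochain F U n) : f.conv (Cochain.convOne U n) = f :=
  Cochain.ext_ev fun _ => convOp_counit (comulHom_counitHom U) _

theorem firstFace_conv {n : ℕ} (f g : Cochain F U n) :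
    firstFace (f.conv g) = (firstFace f).conv (firstFace g) :=
  Cochain.ext_ev fun X => (convOp_whiskerLeftOp (comulHom_braid U (X 0)) _ _).symm

theorem innerFace_conv {n : ℕ} (i : Fin n) (f g : Cochain F U n) :
    innerFace i (f.conv g) = (innerFace i f).conv (innerFace i g) :=
  Cochain.ext_ev fun _ => (convOp_conjOp _ _ _ _).symm

theorem lastFace_conv {n : ℕ} (f g : Cochain F U n) :
    lastFace (f.conv g) = (lastFace f).conv (lastFace g) :=
  Cochain.ext_ev fun X => by
    rw [lastFace_ev_eq, Cochain.conv_ev, Cochain.conv_ev, lastFace_ev_eq, lastFace_ev_eq,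
      convOp_conjOp, convOp_whiskerRightOp]

theorem firstFace_convOne (n : ℕ) :
    firstFace (Cochain.convOne U n) = Cochain.convOne U (n + 1) :=
  Cochain.ext_ev fun X => whiskerLeftOp_counit (counitHom_braid U (X 0)) _

theorem lastFace_convOne (n : ℕ) :
    lastFace (Cochain.convOne U n) = Cochain.convOne U (n + 1) :=
  Cochain.ext_ev fun X => by
    rw [lastFace_ev_eq, Cochain.convOne_ev, Cochain.convOne_ev, whiskerRightOp_counit,
      conjOp_counit]

/-- By interchange, `f ⊗ g` is `g` on the right-hand factors followed by `f` on the left-hand ones;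
`convOp` likewise applies its second argument first. -/
theorem cup_eq_conv {m n N : ℕ} (h : m + n = N) (f : Cochain F U m) (g : Cochain F U n) :
    cup U h f g = (frontExtend h f).conv (backExtend h g) :=
  Cochain.ext_ev fun X => by
    rw [Cochain.conv_ev, frontExtend_ev, backExtend_ev, convOp_conjOp]
    simp only [cup, conjOp, convOp, whiskerRightOp, whiskerLeftOp,
      MonoidalCategory.tensorHom_def', MonoidalCategory.whiskerLeft_comp, Category.assoc]
    simp only [associator_inv_naturality_right_assoc]
    rfl

theorem sqcup_eq_conv {m n N : ℕ} (h : m + n = N) (f : Cochain F U m) (g : Cochain F U n) :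
    sqcup U h f g = (backExtend h g).conv (frontExtend h f) :=
  Cochain.ext_ev fun X => by
    rw [Cochain.conv_ev, frontExtend_ev, backExtend_ev, convOp_conjOp]
    simp only [sqcup, conjOp, convOp, whiskerRightOp, whiskerLeftOp, Category.assoc]
    rfl

theorem frontExtend_convOne {n : ℕ} (h : 0 + n = n) :
    frontExtend h (Cochain.convOne U 0) = Cochain.convOne U n := by
  induction n with
  | zero => exact frontExtend_zero _ _
  | succ n ih => rw [← lastFace_frontExtend (Nat.zero_add n) h, ih, lastFace_convOne]

theorem backExtend_convOne {n : ℕ} (h : n + 0 = n) :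
    backExtend h (Cochain.convOne U 0) = Cochain.convOne U n := by
  induction n with
  | zero => rfl
  | succ n ih => rw [← firstFace_backExtend (Nat.add_zero n) h, ih, firstFace_convOne]

theorem unit_cup {n : ℕ} (h : 0 + n = n) (f : Cochain F U n) : cup U h (unitCochain U) f = f := by
  rw [cup_eq_conv, unitCochain_eq, frontExtend_convOne, backExtend_zero, Cochain.convOne_conv]

theorem cup_unit {n : ℕ} (h : n + 0 = n) (f : Cochain F U n) : cup U h f (unitCochain U) = f := by
  rw [cup_eq_conv, unitCochain_eq, backExtend_convOne, frontExtend_zero, Cochain.conv_convOne]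

theorem unit_sqcup {n : ℕ} (h : 0 + n = n) (f : Cochain F U n) :
    sqcup U h (unitCochain U) f = f := by
  rw [sqcup_eq_conv, unitCochain_eq, frontExtend_convOne, backExtend_zero, Cochain.conv_convOne]

theorem sqcup_unit {n : ℕ} (h : n + 0 = n) (f : Cochain F U n) :
    sqcup U h f (unitCochain U) = f := by
  rw [sqcup_eq_conv, unitCochain_eq, backExtend_convOne, frontExtend_zero, Cochain.convOne_conv]

end Convolution

/-! ### The coface system on the product of the convolution rings, and its consequences for
cochains. -/

section ConvolutionRing

variable {C : Type u₁} [Category.{v₁} C] [MonoidalCategory C]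
variable {D : Type u₂} [Category.{v₂} D] [MonoidalCategory D] [Preadditive D]
variable {F : C ⥤ D} [F.Monoidal] {U : Centralizer F}

/-- The coface operators `C^n(F, U) → C^{n+1}(F, U)`: the first face, the `n` inner faces, and the
last face in all the remaining positions. -/
def coface {n : ℕ} : ℕ → Cochain F U n → Cochain F U (n + 1)
  | 0, f => firstFace f
  | j + 1, f => if h : j < n then innerFace ⟨j, h⟩ f else lastFace f

set_option linter.unusedSectionVars false in
theorem coface_zero {n : ℕ} (f : Cochain F U n) : coface 0 f = firstFace f := rfl

set_option linter.unusedSectionVars false in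
theorem coface_succ {n j : ℕ} (h : j < n) (f : Cochain F U n) :
    coface (j + 1) f = innerFace ⟨j, h⟩ f := dif_pos h

set_option linter.unusedSectionVars false in
theorem coface_of_lt {n j : ℕ} (h : n < j) (f : Cochain F U n) : coface j f = lastFace f := by
  obtain ⟨j, rfl⟩ : ∃ l, j = l + 1 := ⟨j - 1, by omega⟩
  exact dif_neg (by omega)

-- Because the last face is repeated in every higher position, the identity holds for all `i ≤ j`,
-- with no bound by the degree, as `CofaceSystem` demands.
set_option linter.unusedSectionVars false in
theorem coface_comm {n i j : ℕ} (h : i ≤ j) (f : Cochain F U n) :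
    coface (j + 1) (coface i f) = coface i (coface j f) := by
  rcases i with _ | i
  · rw [coface_zero, coface_zero]
    rcases j with _ | j
    · rw [coface_succ (Nat.succ_pos n), coface_zero]
      exact innerFace_zero_firstFace f
    · by_cases hj : j < n
      · rw [coface_succ (Nat.succ_lt_succ hj), coface_succ hj]
        exact innerFace_succ_firstFace ⟨j, hj⟩ f
      · rw [coface_of_lt (by omega), coface_of_lt (by omega), lastFace_firstFace]
  · obtain ⟨j, rfl⟩ : ∃ l, j = l + 1 := ⟨j - 1, by omega⟩
    by_cases hj : j < n
    · rw [coface_succ (Nat.succ_lt_succ hj), coface_succ (show i < n by omega),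
        coface_succ (show i < n + 1 by omega), coface_succ hj]
      exact innerFace_succ_innerFace (a := ⟨i, by omega⟩) (c := ⟨j, hj⟩)
        (Nat.le_of_succ_le_succ h) f
    · rw [coface_of_lt (by omega), coface_of_lt (j := j + 1) (by omega)]
      by_cases hi : i < n
      · rw [coface_succ hi, coface_succ (show i < n + 1 by omega)]
        exact lastFace_innerFace ⟨i, hi⟩ f
      · rw [coface_of_lt (by omega)]
        by_cases hi' : i < n + 1
        · rw [coface_succ hi']
          obtain rfl : i = n := by omega
          exact lastFace_lastFace f
        · rw [coface_of_lt (by omega)]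

theorem convOp_add [MonoidalPreadditive D] {V P : D} (Δ : V ⟶ V ⊗ V) (a b c : V ⊗ P ⟶ P) :
    convOp Δ a (b + c) = convOp Δ a b + convOp Δ a c := by
  simp [convOp, MonoidalPreadditive.whiskerLeft_add]

set_option linter.unusedSectionVars false in
theorem add_convOp {V P : D} (Δ : V ⟶ V ⊗ V) (a b c : V ⊗ P ⟶ P) :
    convOp Δ (a + b) c = convOp Δ a c + convOp Δ b c := by
  simp [convOp]

variable [MonoidalPreadditive D] [ComonObj U]

/-- The ring structure on cochains of a fixed degree given by convolution. -/
abbrev Cochain.nonUnitalRing (n : ℕ) : NonUnitalRing (Cochain F U n) where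
  -- The additive structure is that of natural transformations, so that it agrees with the one used
  -- by the differential.
  __ := (inferInstance : AddCommGroup (Cochain F U n))
  mul f g := f.conv g
  mul_assoc := Cochain.conv_assoc
  left_distrib f g h := Cochain.ext_ev fun _ => convOp_add _ _ _ _
  right_distrib f g h := Cochain.ext_ev fun _ => add_convOp _ _ _ _
  zero_mul f := Cochain.ext_ev fun X => by
    change convOp _ 0 _ = 0
    simp [convOp]
  mul_zero f := Cochain.ext_ev fun X => by
    change convOp _ _ 0 = 0
    simp [convOp]

attribute [local instance] Cochain.nonUnitalRing

theorem Cochain.conv_add {n : ℕ} (f g l : Cochain F U n) :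
    f.conv (g + l) = f.conv g + f.conv l := mul_add f g l

theorem Cochain.add_conv {n : ℕ} (f g l : Cochain F U n) :
    (f + g).conv l = f.conv l + g.conv l := add_mul f g l

theorem coface_mul {n : ℕ} (j : ℕ) (f g : Cochain F U n) :
    coface j (f * g) = coface j f * coface j g := by
  rcases j with _ | j
  · exact firstFace_conv f g
  · by_cases h : j < n
    · simp only [coface_succ h]
      exact innerFace_conv _ f g
    · simp only [coface_of_lt (show n < j + 1 by omega)]
      exact lastFace_conv f g

set_option linter.unusedSectionVars false in
theorem coface_add {n : ℕ} (j : ℕ) (f g : Cochain F U n) :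
    coface j (f + g) = coface j f + coface j g := by
  rcases j with _ | j
  · exact firstFace_add f g
  · by_cases h : j < n
    · simp only [coface_succ h]
      exact innerFace_add _ f g
    · simp only [coface_of_lt (show n < j + 1 by omega)]
      exact lastFace_add f g

set_option linter.unusedSectionVars false in
theorem coface_map_zero {n : ℕ} (j : ℕ) : coface j (0 : Cochain F U n) = 0 := by
  have h := coface_add j (0 : Cochain F U n) 0
  rwa [add_zero, left_eq_add] at h

/-- The coface operators on the product of the rings of cochains. -/
def cofaceHom (U : Centralizer F) [ComonObj U] (j : ℕ) :
    (∀ n, Cochain F U n) →ₙ+* (∀ n, Cochain F U n) where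
  toFun x
    -- Nothing maps into degree `0`, so the operators do not preserve the unit of the product ring;
    -- hence the non-unital setting.
    | 0 => 0
    | n + 1 => coface j (x n)
  map_mul' _ _ := funext fun
    | 0 => (mul_zero _).symm
    | _ + 1 => coface_mul j _ _
  map_zero' := funext fun
    | 0 => rfl
    | _ + 1 => coface_map_zero j
  map_add' _ _ := funext fun
    | 0 => (add_zero _).symm
    | _ + 1 => coface_add j _ _

/-- The system of coface operators on the product of the rings of cochains. -/
def cofaceSystem (U : Centralizer F) [ComonObj U] : CofaceSystem (∀ n, Cochain F U n) where
  D := cofaceHom U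
  comm' {i j} h x := funext fun
    | 0 => rfl
    | 1 => (coface_map_zero (n := 0) (F := F) (U := U) (j + 1)).trans
        (coface_map_zero (n := 0) i).symm
    | n + 2 => coface_comm h (x n)

theorem cofaceSystem_D_single {n : ℕ} (j : ℕ) (f : Cochain F U n) :
    (cofaceSystem U).D j (Pi.single n f) = Pi.single (n + 1) (coface j f) := by
  funext N
  rcases N with _ | N
  · rw [Pi.single_eq_of_ne (by omega)]
    rfl
  · change coface j (Pi.single n f N) = _
    rcases eq_or_ne N n with rfl | h
    · rw [Pi.single_eq_same, Pi.single_eq_same]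
    · rw [Pi.single_eq_of_ne h, Pi.single_eq_of_ne (by omega), coface_map_zero]

theorem cofaceSystem_pow_last {m n N : ℕ} (h : m + n = N) (f : Cochain F U m) :
    (cofaceSystem U).pow (m + 1) n (Pi.single m f) = Pi.single N (frontExtend h f) := by
  induction n generalizing N with
  | zero =>
    obtain rfl : m = N := h
    rw [frontExtend_zero]
    rfl
  | succ n ih =>
    obtain rfl := h
    -- In degree `m + n` with `n > 0` the operator `D (m + 1)` is an inner face; on this iterated
    -- image it may be replaced by `D (m + 1 + n)`, which is the last face.
    rw [← (cofaceSystem U).D_pow_mid (j := m + 1 + n) (by omega) le_rfl, ih rfl,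
      cofaceSystem_D_single, coface_of_lt (by omega), lastFace_frontExtend rfl rfl]
    rfl

theorem cofaceSystem_pow_zero {m n N : ℕ} (h : m + n = N) (g : Cochain F U n) :
    (cofaceSystem U).pow 0 m (Pi.single n g) = Pi.single N (backExtend h g) := by
  induction m generalizing N with
  | zero =>
    obtain rfl : n = N := (Nat.zero_add n).symm.trans h
    rfl
  | succ m ih =>
    obtain ⟨N, rfl⟩ : ∃ l, N = l + 1 := ⟨m + n, by omega⟩
    rw [CofaceSystem.pow_succ', ih (show m + n = N by omega), cofaceSystem_D_single, coface_zero]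
    rfl

theorem cofaceSystem_cup {m n N : ℕ} (h : m + n = N) (f : Cochain F U m) (g : Cochain F U n) :
    (cofaceSystem U).cup m n (Pi.single m f) (Pi.single n g) = Pi.single N (cup U h f g) := by
  rw [CofaceSystem.cup, cofaceSystem_pow_last h, cofaceSystem_pow_zero h, cup_eq_conv,
    ← Pi.single_mul]
  rfl

theorem cofaceSystem_sqcup {m n N : ℕ} (h : m + n = N) (f : Cochain F U m) (g : Cochain F U n) :
    (cofaceSystem U).pow 0 m (Pi.single n g) * (cofaceSystem U).pow (m + 1) n (Pi.single m f) =
      Pi.single N (sqcup U h f g) := by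
  rw [cofaceSystem_pow_last h, cofaceSystem_pow_zero h, sqcup_eq_conv, ← Pi.single_mul]
  rfl

theorem cofaceSystem_op_cup {m n N : ℕ} (h : m + n = N) (f : Cochain F U m)
    (g : Cochain F U n) :
    (cofaceSystem U).op.cup m n (MulOpposite.op (Pi.single m f)) (MulOpposite.op (Pi.single n g)) =
      MulOpposite.op (Pi.single N (sqcup U h f g)) := by
  rw [CofaceSystem.op_cup, cofaceSystem_sqcup h]

variable (k : Type w) [Field k] [Linear k D] [MonoidalLinear k D]

set_option linter.unusedSectionVars false in
theorem differential_eq_sum {n : ℕ} (f : Cochain F U n) :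
    differential k U n f = ∑ j ∈ Finset.range (n + 2), (-1 : ℤ) ^ j • coface j f := by
  rw [Finset.sum_range_succ, Finset.sum_range_succ', coface_of_lt (Nat.lt_succ_self n),
    coface_zero, pow_zero, one_smul, Finset.sum_range, add_comm (∑ _, _)]
  refine congrArg (firstFace f + · + _) (Finset.sum_congr rfl fun i _ => ?_)
  rw [coface_succ i.2]

/-- Needed for elements that are not concentrated in one degree: the homotopy of `exists_delta_eq`
is only known to be some element of the product ring. -/
theorem cofaceSystem_delta_apply (n : ℕ) (x : ∀ n, Cochain F U n) :
    (cofaceSystem U).delta n x (n + 1) = differential k U n (x n) := by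
  rw [differential_eq_sum, CofaceSystem.delta, Finset.sum_apply]
  rfl

theorem cofaceSystem_delta {n : ℕ} (f : Cochain F U n) :
    (cofaceSystem U).delta n (Pi.single n f) = Pi.single (n + 1) (differential k U n f) := by
  rw [differential_eq_sum, CofaceSystem.delta]
  simp only [cofaceSystem_D_single, ← Pi.single_smul]
  exact (map_sum (AddMonoidHom.single (fun n => Cochain F U n) (n + 1)) _ _).symm

theorem differential_unitCochain : differential k U 0 (unitCochain U) = 0 := by
  simp only [differential_eq_sum, Finset.sum_range_succ, Finset.sum_range_zero]
  rw [coface_zero, coface_of_lt Nat.zero_lt_one, unitCochain_eq, firstFace_convOne,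
    lastFace_convOne]
  simp

theorem differential_comp_differential (n : ℕ) :
    differential k U (n + 1) ∘ₗ differential k U n = 0 :=
  LinearMap.ext fun f => by
    have h := (cofaceSystem U).delta_delta n (Pi.single n f)
    rw [cofaceSystem_delta k, cofaceSystem_delta k] at h
    exact Pi.single_eq_zero_iff.mp h

theorem differential_cup {m n N : ℕ} (h : m + n = N) (h₁ : m + 1 + n = N + 1)
    (h₂ : m + (n + 1) = N + 1) (f : Cochain F U m) (g : Cochain F U n) :
    differential k U N (cup U h f g) = cup U h₁ (differential k U m f) g +
      (-1 : ℤ) ^ m • cup U h₂ f (differential k U n g) := by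
  have e := (cofaceSystem U).delta_cup m n (Pi.single m f) (Pi.single n g)
  rw [cofaceSystem_delta k, cofaceSystem_delta k, cofaceSystem_cup h, cofaceSystem_cup h₁,
    cofaceSystem_cup h₂, h, cofaceSystem_delta k, ← Pi.single_smul, ← Pi.single_add] at e
  exact Pi.single_injective _ e

theorem differential_sqcup {m n N : ℕ} (h : m + n = N) (h₁ : m + 1 + n = N + 1)
    (h₂ : m + (n + 1) = N + 1) (f : Cochain F U m) (g : Cochain F U n) :
    differential k U N (sqcup U h f g) = sqcup U h₁ (differential k U m f) g +
      (-1 : ℤ) ^ m • sqcup U h₂ f (differential k U n g) := by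
  have e := (cofaceSystem U).op.delta_cup m n (MulOpposite.op (Pi.single m f))
    (MulOpposite.op (Pi.single n g))
  simp only [CofaceSystem.op_delta] at e
  rw [cofaceSystem_delta k, cofaceSystem_delta k, cofaceSystem_op_cup h, cofaceSystem_op_cup h₁,
    cofaceSystem_op_cup h₂, h, CofaceSystem.op_delta, cofaceSystem_delta k] at e
  replace e := congrArg MulOpposite.unop e
  rw [MulOpposite.unop_add, MulOpposite.unop_smul, MulOpposite.unop_op, MulOpposite.unop_op,
    MulOpposite.unop_op, ← Pi.single_smul, ← Pi.single_add] at e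
  exact Pi.single_injective _ e

theorem cup_assoc {m n p q r N : ℕ} (h₁ : m + n = q) (h₂ : q + p = N) (h₃ : n + p = r)
    (h₄ : m + r = N) (f : Cochain F U m) (g : Cochain F U n) (l : Cochain F U p) :
    cup U h₂ (cup U h₁ f g) l = cup U h₄ f (cup U h₃ g l) := by
  have e := (cofaceSystem U).cup_assoc m n p (Pi.single m f) (Pi.single n g) (Pi.single p l)
  rw [cofaceSystem_cup h₁, cofaceSystem_cup h₃, h₁, h₃, cofaceSystem_cup h₂,
    cofaceSystem_cup h₄] at e
  exact Pi.single_injective _ e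

theorem sqcup_assoc {m n p q r N : ℕ} (h₁ : m + n = q) (h₂ : q + p = N) (h₃ : n + p = r)
    (h₄ : m + r = N) (f : Cochain F U m) (g : Cochain F U n) (l : Cochain F U p) :
    sqcup U h₂ (sqcup U h₁ f g) l = sqcup U h₄ f (sqcup U h₃ g l) := by
  have e := (cofaceSystem U).op.cup_assoc m n p (MulOpposite.op (Pi.single m f))
    (MulOpposite.op (Pi.single n g)) (MulOpposite.op (Pi.single p l))
  rw [cofaceSystem_op_cup h₁, cofaceSystem_op_cup h₃, h₁, h₃, cofaceSystem_op_cup h₂,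
    cofaceSystem_op_cup h₄] at e
  exact Pi.single_injective _ (MulOpposite.op_injective e)

/-- The two products agree up to sign and order of the factors, modulo coboundaries. -/
theorem cup_sub_sqcup_mem_coboundaries {m n N : ℕ} (h : m + n = N) (h' : n + m = N)
    {f : Cochain F U m} {g : Cochain F U n} (hf : differential k U m f = 0)
    (hg : differential k U n g = 0) :
    (-1 : ℤ) ^ (m * n) • cup U h f g - sqcup U h' g f ∈ coboundaries k U N := by
  have hf' : (cofaceSystem U).delta m (Pi.single m f) = 0 := by
    rw [cofaceSystem_delta k, hf, Pi.single_zero]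
  have hg' : (cofaceSystem U).delta n (Pi.single n g) = 0 := by
    rw [cofaceSystem_delta k, hg, Pi.single_zero]
  have hc := cofaceSystem_cup h f g
  have hs := cofaceSystem_sqcup h' g f
  -- For `g` of degree `0` the two products are equal on the nose; in positive degree the homotopy
  -- applies.
  rcases n with _ | n
  · rw [(cofaceSystem U).pow_one_eq_of_delta hg' m, CofaceSystem.pow_zero] at hs
    rw [CofaceSystem.cup, CofaceSystem.pow_zero, hs] at hc
    rw [Pi.single_injective _ hc]
    simp
  · obtain ⟨N, rfl⟩ : ∃ l, N = l + 1 := ⟨m + n, by omega⟩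
    obtain ⟨x, hx⟩ := (cofaceSystem U).exists_delta_eq hf' hg'
    rw [hc, hs, show m + n = N by omega] at hx
    -- Only the degree `N` component of the homotopy matters.
    refine ⟨x N, ?_⟩
    rw [← cofaceSystem_delta_apply k, hx, Pi.sub_apply, Pi.smul_apply, Pi.single_eq_same,
      Pi.single_eq_same]

end ConvolutionRing

variable {C : Type u₁} [Category.{v₁} C] [MonoidalCategory C]
variable {D : Type u₂} [Category.{v₂} D] [Preadditive D] [MonoidalCategory D]
  [MonoidalPreadditive D]
variable {F : C ⥤ D} [F.Monoidal] {U : Centralizer F}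

/-! ### Bilinearity of the two products over `k`. -/

section Linearity

theorem frontExtend_add {m n N : ℕ} (h : m + n = N) (f g : Cochain F U m) :
    frontExtend h (f + g) = frontExtend h f + frontExtend h g :=
  Cochain.ext_ev fun X => by
    simp only [Cochain.ev_add, frontExtend_ev, conjOp, whiskerRightOp,
      MonoidalPreadditive.add_whiskerRight, Preadditive.comp_add, Preadditive.add_comp]

theorem backExtend_add {m n N : ℕ} (h : m + n = N) (f g : Cochain F U n) :
    backExtend h (f + g) = backExtend h f + backExtend h g :=
  Cochain.ext_ev fun X => by
    simp only [Cochain.ev_add, backExtend_ev, conjOp, whiskerLeftOp,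
      MonoidalPreadditive.whiskerLeft_add, Preadditive.comp_add, Preadditive.add_comp]

variable {k : Type w} [Field k] [Linear k D] [MonoidalLinear k D]

theorem frontExtend_smul {m n N : ℕ} (h : m + n = N) (c : k) (f : Cochain F U m) :
    frontExtend h (c • f) = c • frontExtend h f :=
  Cochain.ext_ev fun X => by
    simp only [Cochain.ev_smul, frontExtend_ev, conjOp, whiskerRightOp,
      MonoidalLinear.smul_whiskerRight, Linear.comp_smul, Linear.smul_comp]

theorem backExtend_smul {m n N : ℕ} (h : m + n = N) (c : k) (f : Cochain F U n) :
    backExtend h (c • f) = c • backExtend h f :=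
  Cochain.ext_ev fun X => by
    simp only [Cochain.ev_smul, backExtend_ev, conjOp, whiskerLeftOp,
      MonoidalLinear.whiskerLeft_smul, Linear.comp_smul, Linear.smul_comp]

variable [ComonObj U]

theorem Cochain.conv_smul {n : ℕ} (c : k) (f g : Cochain F U n) :
    f.conv (c • g) = c • f.conv g :=
  Cochain.ext_ev fun X => by
    simp only [Cochain.ev_smul, Cochain.conv_ev, convOp, MonoidalLinear.whiskerLeft_smul,
      Linear.comp_smul, Linear.smul_comp]

set_option linter.unusedSectionVars false in
theorem Cochain.smul_conv {n : ℕ} (c : k) (f g : Cochain F U n) :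
    (c • f).conv g = c • f.conv g :=
  Cochain.ext_ev fun X => by
    simp only [Cochain.ev_smul, Cochain.conv_ev, convOp, Linear.comp_smul]

variable (k) (U)

/-- The product `cup` as a bilinear map. -/
def cupHom {m n N : ℕ} (h : m + n = N) : Cochain F U m →ₗ[k] Cochain F U n →ₗ[k] Cochain F U N :=
  LinearMap.mk₂ k (cup U h)
    (fun f f' g => by simp only [cup_eq_conv, frontExtend_add, Cochain.add_conv])
    (fun c f g => by simp only [cup_eq_conv, frontExtend_smul, Cochain.smul_conv])
    (fun f g g' => by simp only [cup_eq_conv, backExtend_add, Cochain.conv_add])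
    (fun c f g => by simp only [cup_eq_conv, backExtend_smul, Cochain.conv_smul])

/-- The product `sqcup` as a bilinear map. -/
def sqcupHom {m n N : ℕ} (h : m + n = N) :
    Cochain F U m →ₗ[k] Cochain F U n →ₗ[k] Cochain F U N :=
  LinearMap.mk₂ k (sqcup U h)
    (fun f f' g => by simp only [sqcup_eq_conv, frontExtend_add, Cochain.conv_add])
    (fun c f g => by simp only [sqcup_eq_conv, frontExtend_smul, Cochain.conv_smul])
    (fun f g g' => by simp only [sqcup_eq_conv, backExtend_add, Cochain.add_conv])
    (fun c f g => by simp only [sqcup_eq_conv, backExtend_smul, Cochain.smul_conv])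

end Linearity

/-! ### Descent of a product satisfying the Leibniz rule to cohomology. -/

variable (k : Type w) [Field k] [Linear k D] [MonoidalLinear k D] (U)

/-- An associative unital product on Davydov-Yetter cochains satisfying the Leibniz rule. -/
structure CochainProduct where
  /-- The product. -/
  mul {m n N : ℕ} (h : m + n = N) : Cochain F U m →ₗ[k] Cochain F U n →ₗ[k] Cochain F U N
  /-- The unit. -/
  one : Cochain F U 0
  leibniz {m n N : ℕ} (h : m + n = N) (h₁ : m + 1 + n = N + 1) (h₂ : m + (n + 1) = N + 1)
    (f : Cochain F U m) (g : Cochain F U n) : differential k U N (mul h f g) =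
      mul h₁ (differential k U m f) g + (-1 : ℤ) ^ m • mul h₂ f (differential k U n g)
  mul_assoc {m n p q r N : ℕ} (h₁ : m + n = q) (h₂ : q + p = N) (h₃ : n + p = r)
    (h₄ : m + r = N) (f : Cochain F U m) (g : Cochain F U n) (l : Cochain F U p) :
    mul h₂ (mul h₁ f g) l = mul h₄ f (mul h₃ g l)
  one_mul {n : ℕ} (h : 0 + n = n) (f : Cochain F U n) : mul h one f = f
  mul_one {n : ℕ} (h : n + 0 = n) (f : Cochain F U n) : mul h f one = f
  differential_one : differential k U 0 one = 0

namespace CochainProduct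

variable {k U} (p : CochainProduct U k)

theorem mul_mem_cocycles {m n N : ℕ} (h : m + n = N) {f : Cochain F U m} {g : Cochain F U n}
    (hf : f ∈ cocycles k U m) (hg : g ∈ cocycles k U n) : p.mul h f g ∈ cocycles k U N := by
  rw [LinearMap.mem_ker] at hf hg ⊢
  rw [p.leibniz h (by omega) (by omega), hf, hg]
  simp

theorem mul_mem_coboundaries_of_left {m n N : ℕ} (h : m + n = N) {f : Cochain F U m}
    {g : Cochain F U n} (hf : f ∈ coboundaries k U m) (hg : g ∈ cocycles k U n) :
    p.mul h f g ∈ coboundaries k U N := by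
  rcases m with _ | m
  · rw [show f = 0 from hf, map_zero, LinearMap.zero_apply]
    exact zero_mem _
  · obtain ⟨f, rfl⟩ := hf
    obtain ⟨N, rfl⟩ : ∃ l, N = l + 1 := ⟨m + n, by omega⟩
    rw [LinearMap.mem_ker] at hg
    refine ⟨p.mul (show m + n = N by omega) f g, ?_⟩
    rw [p.leibniz _ h (by omega), hg, map_zero, smul_zero, add_zero]

theorem mul_mem_coboundaries_of_right {m n N : ℕ} (h : m + n = N) {f : Cochain F U m}
    {g : Cochain F U n} (hf : f ∈ cocycles k U m) (hg : g ∈ coboundaries k U n) :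
    p.mul h f g ∈ coboundaries k U N := by
  rcases n with _ | n
  · rw [show g = 0 from hg, map_zero]
    exact zero_mem _
  · obtain ⟨g, rfl⟩ := hg
    obtain ⟨N, rfl⟩ : ∃ l, N = l + 1 := ⟨m + n, by omega⟩
    rw [LinearMap.mem_ker] at hf
    -- The sign cancels the `(-1)^m` of the Leibniz rule.
    refine ⟨(-1 : ℤ) ^ m • p.mul (show m + n = N by omega) f g, ?_⟩
    rw [map_zsmul, p.leibniz _ (by omega) h, hf, map_zero, LinearMap.zero_apply, zero_add,
      smul_smul, ← pow_add, Even.neg_one_pow ⟨m, rfl⟩, one_smul]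

/-- The product of cocycles, with values in cohomology. -/
def cocycleMul {m n N : ℕ} (h : m + n = N) :
    cocycles k U m →ₗ[k] cocycles k U n →ₗ[k] Cohomology k U N :=
  LinearMap.mk₂ k
    (fun f g => cohomologyClass k U N ⟨p.mul h f.1 g.1, p.mul_mem_cocycles h f.2 g.2⟩)
    (fun f f' g => by
      rw [← map_add]; congr 1; ext1; simp)
    (fun c f g => by
      rw [← map_smul]; congr 1; ext1; simp)
    (fun f g g' => by
      rw [← map_add]; congr 1; ext1; simp)
    (fun c f g => by
      rw [← map_smul]; congr 1; ext1; simp)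

theorem cohomologyClass_eq_zero {n : ℕ} {f : cocycles k U n} :
    cohomologyClass k U n f = 0 ↔ f.1 ∈ coboundaries k U n := by
  rw [Submodule.mkQ_apply, Submodule.Quotient.mk_eq_zero]
  exact Iff.rfl

/-- The product induced on cohomology. -/
def cohomologyMul {m n N : ℕ} (h : m + n = N) :
    Cohomology k U m →ₗ[k] Cohomology k U n →ₗ[k] Cohomology k U N :=
  -- The quotient is taken in the first variable, then, after a flip, in the second; the final flip
  -- restores the order.
  (Submodule.liftQ _ (Submodule.liftQ _ (p.cocycleMul h) (fun f hf => by
    rw [LinearMap.mem_ker]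
    ext1 g
    exact cohomologyClass_eq_zero.mpr (p.mul_mem_coboundaries_of_left h hf g.2))).flip
      (fun g hg => by
    rw [LinearMap.mem_ker]
    ext f
    exact cohomologyClass_eq_zero.mpr (p.mul_mem_coboundaries_of_right h f.2 hg))).flip

theorem cohomologyMul_class {m n N : ℕ} (h : m + n = N) (f : cocycles k U m)
    (g : cocycles k U n) :
    p.cohomologyMul h (cohomologyClass k U m f) (cohomologyClass k U n g) =
      cohomologyClass k U N ⟨p.mul h f.1 g.1, p.mul_mem_cocycles h f.2 g.2⟩ := rfl

/-- In the direct sum the target degree can be exchanged for an equal one, which lets the laws be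
checked on representatives of a single degree. -/
theorem of_cohomologyMul_cast {m n N N' : ℕ} (h : m + n = N) (h' : m + n = N')
    (a : Cohomology k U m) (b : Cohomology k U n) :
    DirectSum.of (Cohomology k U) N (p.cohomologyMul h a b) =
      DirectSum.of (Cohomology k U) N' (p.cohomologyMul h' a b) := by
  subst h
  subst h'
  rfl

/-- The graded algebra structure on cohomology induced by a product on cochains. -/
def toGradedAlgebraStructure : GradedAlgebraStructure k (Cohomology k U) where
  mul m n := p.cohomologyMul rfl
  one := cohomologyClass k U 0 ⟨p.one, p.differential_one⟩
  mul_assoc {m n l} a b c := by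
    obtain ⟨a, rfl⟩ := Submodule.mkQ_surjective _ a
    obtain ⟨b, rfl⟩ := Submodule.mkQ_surjective _ b
    obtain ⟨c, rfl⟩ := Submodule.mkQ_surjective _ c
    rw [p.of_cohomologyMul_cast rfl (show m + n + l = m + (n + l) by omega)]
    rw [cohomologyMul_class, cohomologyMul_class, cohomologyMul_class, cohomologyMul_class]
    congr 2
    exact Subtype.ext (p.mul_assoc _ _ _ _ _ _ _)
  one_mul {n} a := by
    obtain ⟨a, rfl⟩ := Submodule.mkQ_surjective _ a
    rw [p.of_cohomologyMul_cast rfl (Nat.zero_add n), cohomologyMul_class]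
    congr 2
    exact Subtype.ext (p.one_mul _ _)
  mul_one {n} a := by
    obtain ⟨a, rfl⟩ := Submodule.mkQ_surjective _ a
    rw [p.of_cohomologyMul_cast rfl (Nat.add_zero n), cohomologyMul_class]
    congr 2
    exact Subtype.ext (p.mul_one _ _)

end CochainProduct

/-! ### The two products on cohomology and their comparison. -/

variable [ComonObj U]

/-- The product `cup` on cochains. -/
def cupProduct : CochainProduct U k where
  mul h := cupHom U k h
  one := unitCochain U
  leibniz := differential_cup k
  mul_assoc := cup_assoc
  one_mul := unit_cup
  mul_one := cup_unit
  differential_one := differential_unitCochain k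

/-- The product `sqcup` on cochains. -/
def sqcupProduct : CochainProduct U k where
  mul h := sqcupHom U k h
  one := unitCochain U
  leibniz := differential_sqcup k
  mul_assoc := sqcup_assoc
  one_mul := unit_sqcup
  mul_one := sqcup_unit
  differential_one := differential_unitCochain k

theorem of_cupProduct_eq {m n : ℕ} (a : Cohomology k U m) (b : Cohomology k U n) :
    DirectSum.of (Cohomology k U) (m + n) ((cupProduct U k).cohomologyMul rfl a b) =
      (-1 : ℤ) ^ (m * n) •
        DirectSum.of (Cohomology k U) (n + m) ((sqcupProduct U k).cohomologyMul rfl b a) := by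
  obtain ⟨f, rfl⟩ := Submodule.mkQ_surjective _ a
  obtain ⟨g, rfl⟩ := Submodule.mkQ_surjective _ b
  rw [(sqcupProduct U k).of_cohomologyMul_cast rfl (Nat.add_comm n m)]
  have h := cup_sub_sqcup_mem_coboundaries k (U := U) (rfl : m + n = m + n) (Nat.add_comm n m)
    f.2 g.2
  have h' : (-1 : ℤ) ^ (m * n) • (cupProduct U k).cohomologyMul rfl
      (cohomologyClass k U m f) (cohomologyClass k U n g) =
      (sqcupProduct U k).cohomologyMul (Nat.add_comm n m)
        (cohomologyClass k U n g) (cohomologyClass k U m f) := by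
    rw [CochainProduct.cohomologyMul_class, CochainProduct.cohomologyMul_class, ← map_zsmul,
      ← sub_eq_zero, ← map_sub]
    exact CochainProduct.cohomologyClass_eq_zero.mpr h
  rw [← h']
  -- The sign stands on the other side in `h'`; being `1` or `-1`, it is its own inverse.
  rcases neg_one_pow_eq_or ℤ (m * n) with e | e
  · rw [e, one_smul, one_smul]
  · rw [e, neg_smul, one_smul, neg_smul, one_smul, map_neg]
    exact (@neg_neg (DirectSum ℕ (Cohomology k U)) _ _).symm

end DavydovYetter

end

theorem theorem3p7 (k : Type*) [Field k]
    {C : Type*} [Category* C] [Abelian C] [Linear k C]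
    [MonoidalCategory C] [MonoidalPreadditive C] [MonoidalLinear k C]
    {D : Type*} [Category* D] [Abelian D] [Linear k D]
    [MonoidalCategory D] [MonoidalPreadditive D] [MonoidalLinear k D]
    (F : C ⥤ D) [F.Monoidal] [F.Additive] [F.Linear k]
    (U : DavydovYetter.Centralizer F) [ComonObj U] :
    (∀ n : ℕ, DavydovYetter.differential k U (n + 1) ∘ₗ DavydovYetter.differential k U n = 0) ∧
    ∃ A B : DavydovYetter.GradedAlgebraStructure k (DavydovYetter.Cohomology k U),
      (∀ (m n : ℕ) (f : DavydovYetter.cocycles k U m) (g : DavydovYetter.cocycles k U n),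
        ∃ hfg : DavydovYetter.cup U rfl f.1 g.1 ∈ DavydovYetter.cocycles k U (m + n),
          A.mul m n (DavydovYetter.cohomologyClass k U m f)
              (DavydovYetter.cohomologyClass k U n g) =
            DavydovYetter.cohomologyClass k U (m + n) ⟨_, hfg⟩) ∧
      (∀ (m n : ℕ) (f : DavydovYetter.cocycles k U m) (g : DavydovYetter.cocycles k U n),
        ∃ hfg : DavydovYetter.sqcup U rfl f.1 g.1 ∈ DavydovYetter.cocycles k U (m + n),
          B.mul m n (DavydovYetter.cohomologyClass k U m f)
              (DavydovYetter.cohomologyClass k U n g) =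
            DavydovYetter.cohomologyClass k U (m + n) ⟨_, hfg⟩) ∧
      (∃ h1 : DavydovYetter.unitCochain U ∈ DavydovYetter.cocycles k U 0,
        A.one = DavydovYetter.cohomologyClass k U 0 ⟨_, h1⟩ ∧
        B.one = DavydovYetter.cohomologyClass k U 0 ⟨_, h1⟩) ∧
      ∀ (m n : ℕ) (a : DavydovYetter.Cohomology k U m) (b : DavydovYetter.Cohomology k U n),
        DirectSum.of (DavydovYetter.Cohomology k U) (m + n) (A.mul m n a b) =
          (-1 : ℤ) ^ (m * n) •
            DirectSum.of (DavydovYetter.Cohomology k U) (n + m) (B.mul n m b a) := by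
  refine ⟨DavydovYetter.differential_comp_differential k,
    (DavydovYetter.cupProduct U k).toGradedAlgebraStructure,
    (DavydovYetter.sqcupProduct U k).toGradedAlgebraStructure,
    fun m n f g => ⟨_, (DavydovYetter.cupProduct U k).cohomologyMul_class rfl f g⟩,
    fun m n f g => ⟨_, (DavydovYetter.sqcupProduct U k).cohomologyMul_class rfl f g⟩,
    ⟨_, rfl, rfl⟩, fun m n a b => DavydovYetter.of_cupProduct_eq U k a b⟩
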